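/- Let $\mathcal H_{tw}$ be the twisted Heisenberg category: the strict $\mathbb C$-linear monoidal category with $\mathbb Z/2$-graded morphism spaces (a monoidal supercategory, so that $(f\otimes g)(h\otimes k)=(-1)^{|g||h|}fh\otimes gk$ for homogeneous $g,h$) whose objects are words in $P$ (upward strand) and $Q$ (downward strand), and whose morphisms are generated, up to planar isotopy (diagrams are read from bottom to top), by the even upward crossing $X:PP\to PP$, the four even oriented cups $1\to QP$, $1\to PQ$ and caps $PQ\to1$, $QP\to 1$, and an odd hollow dot on each of $P$ and $Q$ (written $c_P$, $c_Q$), subject to the following relations. (i) $X^2=\mathrm{id}_{PP}$, $X$ satisfies the braid relation, and the composite $PQ\to QP\to PQ$ of the two rotated crossings is $\mathrm{id}_{PQ}$. (ii) The composite $QP\to PQ\to QP$ is $\mathrm{id}_{QP}-\mathrm{cup}\circ\mathrm{cap}-(c_Q\otimes 1)\circ\mathrm{cup}\circ\mathrm{cap}\circ(1\otimes c_P)$, with the cup $1\to QP$ and the cap $QP\to 1$. (iii) The counterclockwise bubble is $1$, the counterclockwise bubble with one hollow dot is $0$, and an upward strand with a curl on its left is $0$. (iv) Hollow dots slide through upward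 crossings without sign. A hollow dot slides along the cap $PQ\to 1$ and the cup $1\to QP$ without sign, and along the cap $QP\to1$ and the cup $1\to PQ$ with sign $-1$. Moreover $c_P^2=\mathrm{id}_P$ and $c_Q^2=-\mathrm{id}_Q$. A solid dot on an upward strand denotes the upward strand with a curl on its right; a solid dot on a downward strand is its rotation by a half turn. The even trace of $\mathcal H_{tw}$ is the algebra $\operatorname{Tr}(\mathcal H_{tw})_{\bar 0}=\big(\bigoplus_x \operatorname{End}_{\bar 0}(x)\big)/\mathcal I_{\bar 0}$, where $\operatorname{End}_{\bar 0}(x)$ is the space of even endomorphisms of the object $x$, the product is induced by $\otimes$ (so $yz$ is $y$ with $z$ placed to its right), and $\mathcal I_{\bar 0}$ is the two-sided ideal generated by all $fg-gf$ with $f:x\to y$, $g:y\to x$ homogeneous of the same degree. In it let $u_k$ (respectively $v_k$) be the class of an upward (respectively downward) strand carrying $k$ solid dots, and let $d_k$ be the class of the clockwise bubble carrying $k$ solid dots. Then for every integer $n\ge 0$, writing $[y,z]=yz-zy$, $$[d_{2n},u_0]=(2+4n)\,u_{2n}-\sum_{a+b=n-1}(2+4a)\,u_{2a}\,d_{2b},$$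 where $u_{2a}d_{2b}$ is the class of the upward strand with $2a$ solid dots and, to its right, the clockwise bubble with $2b$ solid dots; and $$[d_{2n},v_0]=-(2+4n)\,v_{2n}+\sum_{a+b=n-1}(2+4a)\,d_{2b}\,v_{2a},$$ where $d_{2b}v_{2a}$ is the class of the clockwise bubble with $2b$ solid dots and, to its right, the downward strand with $2a$ solid dots. The sums run over integers $a,b\ge0$ and are empty for $n=0$. -/

import Mathlib

open CategoryTheory
open scoped DirectSum

namespace TwistedHeisenberg

/-! ## The twisted Heisenberg category

A strict `ℂ`-linear monoidal category with a `ℤ/2`-grading on morphisms (a monoidal supercategory),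
given by generators and relations. Objects are words in `P` (an upward strand) and `Q` (a downward
strand), the tensor product of objects is concatenation and the unit object is the empty word.
Diagrams are read from bottom to top. -/

/-- The two generating objects: `P`, the upward strand, and `Q`, the downward strand. -/
inductive Strand : Type
  | P
  | Q
  deriving DecidableEq

/-- Objects: words in `P` and `Q`. -/
abbrev Obj : Type := List Strand

open Strand

/-- Formal `ℂ`-linear diagrams from the word at the bottom to the word at the top. -/
inductive Diagram : Obj → Obj → Type
  /-- vertical strands -/
  | id (X : Obj) : Diagram X X
  /-- `comp g f` is `g ∘ f`: the diagram `g` is stacked on top of `f` -/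
  | comp {X Y Z : Obj} (g : Diagram Y Z) (f : Diagram X Y) : Diagram X Z
  /-- `tensor f g` is `f ⊗ g`: the diagram `g` is placed to the right of `f`, and the hollow dots
  of `f` lie above those of `g` -/
  | tensor {X Y X' Y' : Obj} (f : Diagram X Y) (g : Diagram X' Y') : Diagram (X ++ X') (Y ++ Y')
  | zero (X Y : Obj) : Diagram X Y
  | add {X Y : Obj} (f g : Diagram X Y) : Diagram X Y
  | smul {X Y : Obj} (r : ℂ) (f : Diagram X Y) : Diagram X Y
  /-- a hollow dot on an upward strand -/
  | dotP : Diagram [P] [P]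
  /-- a hollow dot on a downward strand -/
  | dotQ : Diagram [Q] [Q]
  /-- the crossing of two upward strands -/
  | cross : Diagram [P, P] [P, P]
  /-- the cup whose left end points down and whose right end points up -/
  | cupQP : Diagram [] [Q, P]
  /-- the cup whose left end points up and whose right end points down -/
  | cupPQ : Diagram [] [P, Q]
  /-- the cap oriented from left to right -/
  | capPQ : Diagram [P, Q] []
  /-- the cap oriented from right to left -/
  | capQP : Diagram [Q, P] []

namespace Diagram

/-- Transport of a diagram along equalities of words (strictness of the tensor product). -/
def cast {X Y X' Y' : Obj} (hX : X = X') (hY : Y = Y') (f : Diagram X Y) : Diagram X' Y' :=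
  hX ▸ hY ▸ f

/-- The difference of two diagrams. -/
noncomputable def sub {X Y : Obj} (f g : Diagram X Y) : Diagram X Y := add f (smul (-1) g)

/-- `IsHomog p f`: the formal diagram `f` is homogeneous of degree `p`, where hollow dots have
degree one and all other generators have degree zero. -/
inductive IsHomog : ZMod 2 → {X Y : Obj} → Diagram X Y → Prop
  | id (X : Obj) : IsHomog 0 (id X)
  | comp {p q : ZMod 2} {X Y Z : Obj} {g : Diagram Y Z} {f : Diagram X Y} :
      IsHomog p g → IsHomog q f → IsHomog (p + q) (comp g f)
  | tensor {p q : ZMod 2} {X Y X' Y' : Obj} {f : Diagram X Y} {g : Diagram X' Y'} :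
      IsHomog p f → IsHomog q g → IsHomog (p + q) (tensor f g)
  | zero (p : ZMod 2) (X Y : Obj) : IsHomog p (zero X Y)
  | add {p : ZMod 2} {X Y : Obj} {f g : Diagram X Y} :
      IsHomog p f → IsHomog p g → IsHomog p (add f g)
  | smul {p : ZMod 2} {X Y : Obj} (r : ℂ) {f : Diagram X Y} :
      IsHomog p f → IsHomog p (smul r f)
  | dotP : IsHomog 1 dotP
  | dotQ : IsHomog 1 dotQ
  | cross : IsHomog 0 cross
  | cupQP : IsHomog 0 cupQP
  | cupPQ : IsHomog 0 cupPQ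
  | capPQ : IsHomog 0 capPQ
  | capQP : IsHomog 0 capQP

/-- The Koszul sign `(-1)^{pq}`. -/
noncomputable def koszul (p q : ZMod 2) : ℂ := if p = 1 ∧ q = 1 then -1 else 1

/-- The crossing of an upward strand (from bottom left to top right) with a downward strand,
obtained from the upward crossing by a rotation. -/
def crossPQ : Diagram [P, Q] [Q, P] :=
  comp (tensor (id [Q, P]) capPQ : Diagram [Q, P, P, Q] [Q, P])
    (comp (tensor (id [Q]) (tensor cross (id [Q])) : Diagram [Q, P, P, Q] [Q, P, P, Q])
      (tensor cupQP (id [P, Q]) : Diagram [P, Q] [Q, P, P, Q]))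

/-- The crossing of a downward strand with an upward strand (from bottom right to top left),
obtained from the upward crossing by a rotation. -/
def crossQP : Diagram [Q, P] [P, Q] :=
  comp (tensor capQP (id [P, Q]) : Diagram [Q, P, P, Q] [P, Q])
    (comp (tensor (id [Q]) (tensor cross (id [Q])) : Diagram [Q, P, P, Q] [Q, P, P, Q])
      (tensor (id [Q, P]) cupPQ : Diagram [Q, P] [Q, P, P, Q]))

/-- The upward crossing rotated by a half turn in one direction. -/
def crossQQ : Diagram [Q, Q] [Q, Q] :=
  comp (tensor (id [Q, Q]) capPQ : Diagram [Q, Q, P, Q] [Q, Q])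
    (comp (tensor (id [Q, Q, P]) (tensor capPQ (id [Q])) :
        Diagram [Q, Q, P, P, Q, Q] [Q, Q, P, Q])
      (comp (tensor (id [Q, Q]) (tensor cross (id [Q, Q])) :
          Diagram [Q, Q, P, P, Q, Q] [Q, Q, P, P, Q, Q])
        (comp (tensor (id [Q]) (tensor cupQP (id [P, Q, Q])) :
            Diagram [Q, P, Q, Q] [Q, Q, P, P, Q, Q])
          (tensor cupQP (id [Q, Q]) : Diagram [Q, Q] [Q, P, Q, Q]))))

/-- The upward crossing rotated by a half turn in the other direction. -/
def crossQQ' : Diagram [Q, Q] [Q, Q] :=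
  comp (tensor capQP (id [Q, Q]) : Diagram [Q, P, Q, Q] [Q, Q])
    (comp (tensor (id [Q]) (tensor capQP (id [P, Q, Q])) :
        Diagram [Q, Q, P, P, Q, Q] [Q, P, Q, Q])
      (comp (tensor (id [Q, Q]) (tensor cross (id [Q, Q])) :
          Diagram [Q, Q, P, P, Q, Q] [Q, Q, P, P, Q, Q])
        (comp (tensor (id [Q, Q, P]) (tensor cupPQ (id [Q])) :
            Diagram [Q, Q, P, Q] [Q, Q, P, P, Q, Q])
          (tensor (id [Q, Q]) cupPQ : Diagram [Q, Q] [Q, Q, P, Q]))))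

/-- An upward strand with a curl on its left. -/
def leftCurl : Diagram [P] [P] :=
  comp (tensor capQP (id [P]) : Diagram [Q, P, P] [P])
    (comp (tensor (id [Q]) cross : Diagram [Q, P, P] [Q, P, P])
      (tensor cupQP (id [P]) : Diagram [P] [Q, P, P]))

/-- An upward strand with a curl on its right. -/
def rightCurl : Diagram [P] [P] :=
  comp (tensor (id [P]) capPQ : Diagram [P, P, Q] [P])
    (comp (tensor cross (id [Q]) : Diagram [P, P, Q] [P, P, Q])
      (tensor (id [P]) cupPQ : Diagram [P] [P, P, Q]))

/-- The relations between diagrams: the smallest equivalence relation compatible with all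
operations which contains the axioms of a strict `ℂ`-linear monoidal supercategory, the planar
isotopies, and the defining local relations of the twisted Heisenberg category. -/
inductive Rel : {X Y : Obj} → Diagram X Y → Diagram X Y → Prop
  -- equivalence relation, compatible with the operations
  | refl {X Y : Obj} (f : Diagram X Y) : Rel f f
  | symm {X Y : Obj} {f g : Diagram X Y} : Rel f g → Rel g f
  | trans {X Y : Obj} {f g h : Diagram X Y} : Rel f g → Rel g h → Rel f h
  | comp_congr {X Y Z : Obj} {g g' : Diagram Y Z} {f f' : Diagram X Y} :
      Rel g g' → Rel f f' → Rel (comp g f) (comp g' f')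
  | tensor_congr {X Y X' Y' : Obj} {f f' : Diagram X Y} {g g' : Diagram X' Y'} :
      Rel f f' → Rel g g' → Rel (tensor f g) (tensor f' g')
  | add_congr {X Y : Obj} {f f' g g' : Diagram X Y} :
      Rel f f' → Rel g g' → Rel (add f g) (add f' g')
  | smul_congr {X Y : Obj} (r : ℂ) {f f' : Diagram X Y} :
      Rel f f' → Rel (smul r f) (smul r f')
  -- morphism spaces are complex vector spaces
  | add_assoc {X Y : Obj} (f g h : Diagram X Y) : Rel (add (add f g) h) (add f (add g h))
  | add_comm {X Y : Obj} (f g : Diagram X Y) : Rel (add f g) (add g f)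
  | zero_add {X Y : Obj} (f : Diagram X Y) : Rel (add (zero X Y) f) f
  | zero_smul {X Y : Obj} (f : Diagram X Y) : Rel (smul 0 f) (zero X Y)
  | one_smul {X Y : Obj} (f : Diagram X Y) : Rel (smul 1 f) f
  | mul_smul {X Y : Obj} (r s : ℂ) (f : Diagram X Y) : Rel (smul (r * s) f) (smul r (smul s f))
  | add_smul {X Y : Obj} (r s : ℂ) (f : Diagram X Y) :
      Rel (smul (r + s) f) (add (smul r f) (smul s f))
  | smul_add {X Y : Obj} (r : ℂ) (f g : Diagram X Y) :
      Rel (smul r (add f g)) (add (smul r f) (smul r g))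
  -- category axioms and bilinearity of the composition
  | id_comp {X Y : Obj} (f : Diagram X Y) : Rel (comp (id Y) f) f
  | comp_id {X Y : Obj} (f : Diagram X Y) : Rel (comp f (id X)) f
  | comp_assoc {W X Y Z : Obj} (h : Diagram Y Z) (g : Diagram X Y) (f : Diagram W X) :
      Rel (comp (comp h g) f) (comp h (comp g f))
  | add_comp {X Y Z : Obj} (g g' : Diagram Y Z) (f : Diagram X Y) :
      Rel (comp (add g g') f) (add (comp g f) (comp g' f))
  | comp_add {X Y Z : Obj} (g : Diagram Y Z) (f f' : Diagram X Y) :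
      Rel (comp g (add f f')) (add (comp g f) (comp g f'))
  | smul_comp {X Y Z : Obj} (r : ℂ) (g : Diagram Y Z) (f : Diagram X Y) :
      Rel (comp (smul r g) f) (smul r (comp g f))
  | comp_smul {X Y Z : Obj} (r : ℂ) (g : Diagram Y Z) (f : Diagram X Y) :
      Rel (comp g (smul r f)) (smul r (comp g f))
  -- strict monoidal supercategory axioms
  | add_tensor {X Y X' Y' : Obj} (f f' : Diagram X Y) (g : Diagram X' Y') :
      Rel (tensor (add f f') g) (add (tensor f g) (tensor f' g))
  | tensor_add {X Y X' Y' : Obj} (f : Diagram X Y) (g g' : Diagram X' Y') :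
      Rel (tensor f (add g g')) (add (tensor f g) (tensor f g'))
  | smul_tensor {X Y X' Y' : Obj} (r : ℂ) (f : Diagram X Y) (g : Diagram X' Y') :
      Rel (tensor (smul r f) g) (smul r (tensor f g))
  | tensor_smul {X Y X' Y' : Obj} (r : ℂ) (f : Diagram X Y) (g : Diagram X' Y') :
      Rel (tensor f (smul r g)) (smul r (tensor f g))
  | tensor_id (X Y : Obj) : Rel (tensor (id X) (id Y)) (id (X ++ Y))
  | tensor_assoc {X Y X' Y' X'' Y'' : Obj}
      (f : Diagram X Y) (g : Diagram X' Y') (h : Diagram X'' Y'') :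
      Rel (cast (List.append_assoc X X' X'') (List.append_assoc Y Y' Y'')
        (tensor (tensor f g) h)) (tensor f (tensor g h))
  | unit_tensor {X Y : Obj} (f : Diagram X Y) :
      Rel (cast (List.nil_append X) (List.nil_append Y) (tensor (id []) f)) f
  | tensor_unit {X Y : Obj} (f : Diagram X Y) :
      Rel (cast (List.append_nil X) (List.append_nil Y) (tensor f (id []))) f
  /-- Super interchange law. In particular hollow dots on distinct strands anticommute when their
  relative height is changed, and everything else slides freely. -/
  | interchange {p q : ZMod 2} {X Y Z X' Y' Z' : Obj}
      (f : Diagram Y Z) (g : Diagram Y' Z') (h : Diagram X Y) (k : Diagram X' Y')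
      (hg : IsHomog p g) (hh : IsHomog q h) :
      Rel (comp (tensor f g) (tensor h k)) (smul (koszul p q) (tensor (comp f h) (comp g k)))
  -- planar isotopies: straightening of strands, rotation of crossings
  | zigzag₁ : Rel (comp (tensor capPQ (id [P]) : Diagram [P, Q, P] [P])
      (tensor (id [P]) cupQP : Diagram [P] [P, Q, P])) (id [P])
  | zigzag₂ : Rel (comp (tensor (id [P]) capQP : Diagram [P, Q, P] [P])
      (tensor cupPQ (id [P]) : Diagram [P] [P, Q, P])) (id [P])
  | zigzag₃ : Rel (comp (tensor capQP (id [Q]) : Diagram [Q, P, Q] [Q])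
      (tensor (id [Q]) cupPQ : Diagram [Q] [Q, P, Q])) (id [Q])
  | zigzag₄ : Rel (comp (tensor (id [Q]) capPQ : Diagram [Q, P, Q] [Q])
      (tensor cupQP (id [Q]) : Diagram [Q] [Q, P, Q])) (id [Q])
  | cross_cyclic : Rel crossQQ crossQQ'
  -- double crossings and the braid relation
  | cross_cross : Rel (comp cross cross) (id [P, P])
  | crossQP_crossPQ : Rel (comp crossQP crossPQ) (id [P, Q])
  | braid :
      Rel (comp (tensor cross (id [P]) : Diagram [P, P, P] [P, P, P])
        (comp (tensor (id [P]) cross : Diagram [P, P, P] [P, P, P])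
          (tensor cross (id [P]) : Diagram [P, P, P] [P, P, P])))
      (comp (tensor (id [P]) cross : Diagram [P, P, P] [P, P, P])
        (comp (tensor cross (id [P]) : Diagram [P, P, P] [P, P, P])
          (tensor (id [P]) cross : Diagram [P, P, P] [P, P, P])))
  | crossPQ_crossQP :
      Rel (comp crossPQ crossQP)
        (sub (sub (id [Q, P]) (comp cupQP capQP))
          (comp (comp (tensor dotQ (id [P]) : Diagram [Q, P] [Q, P]) cupQP)
            (comp capQP (tensor (id [Q]) dotP : Diagram [Q, P] [Q, P]))))
  -- counterclockwise bubble and left curl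
  | bubble : Rel (comp capQP cupQP) (id [])
  | leftCurl : Rel leftCurl (zero [P] [P])
  -- hollow dots slide through crossings
  | dot_cross_left :
      Rel (comp cross (tensor dotP (id [P]) : Diagram [P, P] [P, P]))
        (comp (tensor (id [P]) dotP : Diagram [P, P] [P, P]) cross)
  | dot_cross_right :
      Rel (comp cross (tensor (id [P]) dotP : Diagram [P, P] [P, P]))
        (comp (tensor dotP (id [P]) : Diagram [P, P] [P, P]) cross)
  -- hollow dots slide along caps and cups
  | dot_capQP :
      Rel (comp capQP (tensor dotQ (id [P]) : Diagram [Q, P] [Q, P]))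
        (smul (-1) (comp capQP (tensor (id [Q]) dotP : Diagram [Q, P] [Q, P])))
  | dot_capPQ : Rel (comp capPQ (tensor dotP (id [Q]) : Diagram [P, Q] [P, Q]))
        (comp capPQ (tensor (id [P]) dotQ : Diagram [P, Q] [P, Q]))
  | dot_cupQP :
      Rel (comp (tensor dotQ (id [P]) : Diagram [Q, P] [Q, P]) cupQP)
        (comp (tensor (id [Q]) dotP : Diagram [Q, P] [Q, P]) cupQP)
  | dot_cupPQ :
      Rel (comp (tensor dotP (id [Q]) : Diagram [P, Q] [P, Q]) cupPQ)
        (smul (-1) (comp (tensor (id [P]) dotQ : Diagram [P, Q] [P, Q]) cupPQ))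
  -- pairs of hollow dots, and the counterclockwise bubble with one hollow dot
  | dotP_dotP : Rel (comp dotP dotP) (id [P])
  | dotQ_dotQ : Rel (comp dotQ dotQ) (smul (-1) (id [Q]))
  | dot_bubble :
      Rel (comp capQP (comp (tensor (id [Q]) dotP : Diagram [Q, P] [Q, P]) cupQP)) (zero [] [])

end Diagram

/-- The equivalence relation generated by the relations between diagrams. -/
instance diagramSetoid (X Y : Obj) : Setoid (Diagram X Y) :=
  ⟨Diagram.Rel, Diagram.Rel.refl, Diagram.Rel.symm, Diagram.Rel.trans⟩

/-- Morphisms of the twisted Heisenberg category. -/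
def Hom (X Y : Obj) : Type := Quotient (diagramSetoid X Y)

/-- The morphism represented by a diagram. -/
def mk {X Y : Obj} (f : Diagram X Y) : Hom X Y := Quotient.mk _ f

theorem mk_eq {X Y : Obj} {f g : Diagram X Y} (h : Diagram.Rel f g) : mk f = mk g :=
  Quotient.sound h

instance (X Y : Obj) : Add (Hom X Y) :=
  ⟨Quotient.map₂ Diagram.add fun _ _ h _ _ h' => Diagram.Rel.add_congr h h'⟩

instance (X Y : Obj) : Zero (Hom X Y) := ⟨mk (Diagram.zero X Y)⟩

instance (X Y : Obj) : SMul ℂ (Hom X Y) :=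
  ⟨fun r => Quotient.map (Diagram.smul r) fun _ _ h => Diagram.Rel.smul_congr _ h⟩

noncomputable instance (X Y : Obj) : Neg (Hom X Y) := ⟨fun f => (-1 : ℂ) • f⟩

noncomputable instance (X Y : Obj) : AddCommGroup (Hom X Y) where
  nsmul := nsmulRec
  zsmul := zsmulRec
  add_assoc := by rintro ⟨f⟩ ⟨g⟩ ⟨h⟩; exact mk_eq (.add_assoc f g h)
  add_comm := by rintro ⟨f⟩ ⟨g⟩; exact mk_eq (.add_comm f g)
  zero_add := by rintro ⟨f⟩; exact mk_eq (.zero_add f)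
  add_zero := by rintro ⟨f⟩; exact mk_eq (.trans (.add_comm _ _) (.zero_add f))
  neg_add_cancel := by
    rintro ⟨f⟩
    refine mk_eq (.trans (.add_congr (.refl _) (.symm (.one_smul f))) ?_)
    refine .trans (.symm (.add_smul _ _ f)) ?_
    rw [neg_add_cancel]
    exact .zero_smul f

noncomputable instance (X Y : Obj) : Module ℂ (Hom X Y) where
  one_smul := by rintro ⟨f⟩; exact mk_eq (.one_smul f)
  mul_smul := by rintro r s ⟨f⟩; exact mk_eq (.mul_smul r s f)
  smul_zero := by
    intro r
    refine mk_eq (.trans (.smul_congr r (.symm (.zero_smul (Diagram.zero X Y)))) ?_)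
    refine .trans (.symm (.mul_smul _ _ _)) ?_
    rw [mul_zero]
    exact .zero_smul _
  smul_add := by rintro r ⟨f⟩ ⟨g⟩; exact mk_eq (.smul_add r f g)
  add_smul := by rintro r s ⟨f⟩; exact mk_eq (.add_smul r s f)
  zero_smul := by rintro ⟨f⟩; exact mk_eq (.zero_smul f)

/-- The twisted Heisenberg category. In `f ≫ g` the diagram `g` is stacked on top of `f`. -/
instance : Category Obj where
  Hom := Hom
  id X := mk (Diagram.id X)
  comp f g := Quotient.map₂ Diagram.comp (fun _ _ h _ _ h' => Diagram.Rel.comp_congr h h') g f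
  id_comp := by rintro X Y ⟨f⟩; exact mk_eq (.comp_id f)
  comp_id := by rintro X Y ⟨f⟩; exact mk_eq (.id_comp f)
  assoc := by rintro W X Y Z ⟨f⟩ ⟨g⟩ ⟨h⟩; exact mk_eq (.symm (.comp_assoc h g f))

noncomputable instance : Preadditive Obj where
  homGroup X Y := inferInstanceAs (AddCommGroup (Hom X Y))
  add_comp := by rintro X Y Z ⟨f⟩ ⟨f'⟩ ⟨g⟩; exact mk_eq (.comp_add g f f')
  comp_add := by rintro X Y Z ⟨f⟩ ⟨g⟩ ⟨g'⟩; exact mk_eq (.add_comp g g' f)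

noncomputable instance : Linear ℂ Obj where
  homModule X Y := inferInstanceAs (Module ℂ (Hom X Y))
  smul_comp := by rintro X Y Z r ⟨f⟩ ⟨g⟩; exact mk_eq (.comp_smul r g f)
  comp_smul := by rintro X Y Z ⟨f⟩ r ⟨g⟩; exact mk_eq (.smul_comp r g f)

/-- The tensor product of morphisms: `g` is placed to the right of `f`. -/
def tensor {X Y X' Y' : Obj} (f : X ⟶ Y) (g : X' ⟶ Y') : (X ++ X' : Obj) ⟶ (Y ++ Y' : Obj) :=
  Quotient.map₂ Diagram.tensor (fun _ _ h _ _ h' => Diagram.Rel.tensor_congr h h') f g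

theorem add_tensor {X Y X' Y' : Obj} (f f' : X ⟶ Y) (g : X' ⟶ Y') :
    tensor (f + f') g = tensor f g + tensor f' g := by
  rcases f with ⟨f⟩; rcases f' with ⟨f'⟩; rcases g with ⟨g⟩
  exact mk_eq (.add_tensor f f' g)

theorem tensor_add {X Y X' Y' : Obj} (f : X ⟶ Y) (g g' : X' ⟶ Y') :
    tensor f (g + g') = tensor f g + tensor f g' := by
  rcases f with ⟨f⟩; rcases g with ⟨g⟩; rcases g' with ⟨g'⟩
  exact mk_eq (.tensor_add f g g')

theorem smul_tensor {X Y X' Y' : Obj} (r : ℂ) (f : X ⟶ Y) (g : X' ⟶ Y') :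
    tensor (r • f) g = r • tensor f g := by
  rcases f with ⟨f⟩; rcases g with ⟨g⟩
  exact mk_eq (.smul_tensor r f g)

theorem tensor_smul {X Y X' Y' : Obj} (r : ℂ) (f : X ⟶ Y) (g : X' ⟶ Y') :
    tensor f (r • g) = r • tensor f g := by
  rcases f with ⟨f⟩; rcases g with ⟨g⟩
  exact mk_eq (.tensor_smul r f g)

/-- The space of morphisms which are homogeneous of degree `p`. -/
def homog (p : ZMod 2) (X Y : Obj) : Submodule ℂ (X ⟶ Y) where
  carrier := {f | ∃ t : Diagram X Y, Diagram.IsHomog p t ∧ mk t = f}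
  zero_mem' := ⟨_, .zero p X Y, rfl⟩
  add_mem' := by
    rintro _ _ ⟨s, hs, rfl⟩ ⟨t, ht, rfl⟩
    exact ⟨_, .add hs ht, rfl⟩
  smul_mem' := by
    rintro r _ ⟨t, ht, rfl⟩
    exact ⟨_, .smul r ht, rfl⟩

theorem homog_id (X : Obj) : 𝟙 X ∈ homog 0 X X := ⟨_, .id X, rfl⟩

theorem homog_comp {p q : ZMod 2} {X Y Z : Obj} {f : X ⟶ Y} {g : Y ⟶ Z}
    (hf : f ∈ homog p X Y) (hg : g ∈ homog q Y Z) : f ≫ g ∈ homog (p + q) X Z := by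
  obtain ⟨s, hs, rfl⟩ := hf
  obtain ⟨t, ht, rfl⟩ := hg
  exact ⟨_, add_comm q p ▸ .comp ht hs, rfl⟩

theorem homog_tensor {p q : ZMod 2} {X Y X' Y' : Obj} {f : X ⟶ Y} {g : X' ⟶ Y'}
    (hf : f ∈ homog p X Y) (hg : g ∈ homog q X' Y') :
    tensor f g ∈ homog (p + q) (X ++ X') (Y ++ Y') := by
  obtain ⟨s, hs, rfl⟩ := hf
  obtain ⟨t, ht, rfl⟩ := hg
  exact ⟨_, .tensor hs ht, rfl⟩

theorem even_comp {X Y Z : Obj} {f : X ⟶ Y} {g : Y ⟶ Z}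
    (hf : f ∈ homog 0 X Y) (hg : g ∈ homog 0 Y Z) : f ≫ g ∈ homog 0 X Z := by
  simpa using homog_comp hf hg

theorem even_tensor {X Y X' Y' : Obj} {f : X ⟶ Y} {g : X' ⟶ Y'}
    (hf : f ∈ homog 0 X Y) (hg : g ∈ homog 0 X' Y') :
    tensor f g ∈ homog 0 (X ++ X') (Y ++ Y') := by
  simpa using homog_tensor hf hg

/-! ## The even trace -/

/-- The concatenation of words, written additively so that it can index a graded algebra. -/
instance : Add Obj := ⟨fun X Y => X ++ Y⟩

instance : Zero Obj := ⟨[]⟩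

instance : AddMonoid Obj where
  add_assoc := List.append_assoc
  zero_add := List.nil_append
  add_zero := List.append_nil
  nsmul := nsmulRec

/-- Even endomorphisms of the object `X`. -/
abbrev EvenEnd (X : Obj) : Type := homog 0 X X

/-- The tensor product of even endomorphisms. -/
def EvenEnd.tensor {X Y : Obj} (f : EvenEnd X) (g : EvenEnd Y) :
    EvenEnd (X + Y) :=
  ⟨TwistedHeisenberg.tensor f.1 g.1, homog_tensor f.2 g.2⟩

/-- The identity of the unit object, that is, the empty diagram. -/
def EvenEnd.one : EvenEnd 0 := ⟨𝟙 ([] : Obj), homog_id []⟩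

theorem EvenEnd.mk_eq_mk {X Y : Obj} (h : X = Y) (f : EvenEnd X) (g : EvenEnd Y)
    (s : Diagram X X) (t : Diagram Y Y) (hs : mk s = f.1) (ht : mk t = g.1)
    (hst : Diagram.Rel (Diagram.cast h h s) t) : GradedMonoid.mk X f = GradedMonoid.mk Y g := by
  subst h
  have : f = g := Subtype.ext (by rw [← hs, ← ht]; exact mk_eq hst)
  rw [this]

theorem EvenEnd.one_tensor {X : Obj} (f : EvenEnd X) :
    GradedMonoid.mk (0 + X) (EvenEnd.tensor EvenEnd.one f) = GradedMonoid.mk X f := by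
  obtain ⟨_, t, ht, rfl⟩ := f
  exact EvenEnd.mk_eq_mk (zero_add X) _ _ (.tensor (.id []) t) t rfl rfl (.unit_tensor t)

theorem EvenEnd.tensor_one {X : Obj} (f : EvenEnd X) :
    GradedMonoid.mk (X + 0) (EvenEnd.tensor f EvenEnd.one) = GradedMonoid.mk X f := by
  obtain ⟨_, t, ht, rfl⟩ := f
  exact EvenEnd.mk_eq_mk (add_zero X) _ _ (.tensor t (.id [])) t rfl rfl (.tensor_unit t)

theorem EvenEnd.tensor_assoc {X Y Z : Obj}
    (f : EvenEnd X) (g : EvenEnd Y) (h : EvenEnd Z) :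
    GradedMonoid.mk (X + Y + Z) (EvenEnd.tensor (EvenEnd.tensor f g) h) =
      GradedMonoid.mk (X + (Y + Z)) (EvenEnd.tensor f (EvenEnd.tensor g h)) := by
  obtain ⟨_, s, hs, rfl⟩ := f
  obtain ⟨_, t, ht, rfl⟩ := g
  obtain ⟨_, u, hu, rfl⟩ := h
  exact EvenEnd.mk_eq_mk (add_assoc X Y Z) _ _ (.tensor (.tensor s t) u) (.tensor s (.tensor t u))
    rfl rfl (.tensor_assoc s t u)

theorem EvenEnd.smul_tensor {X Y : Obj} (r : ℂ) (f : EvenEnd X) (g : EvenEnd Y) :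
    EvenEnd.tensor (r • f) g = r • EvenEnd.tensor f g :=
  Subtype.ext (TwistedHeisenberg.smul_tensor r f.1 g.1)

theorem EvenEnd.tensor_smul {X Y : Obj} (r : ℂ) (f : EvenEnd X) (g : EvenEnd Y) :
    EvenEnd.tensor f (r • g) = r • EvenEnd.tensor f g :=
  Subtype.ext (TwistedHeisenberg.tensor_smul r f.1 g.1)

instance : GradedMonoid.GMul EvenEnd := ⟨EvenEnd.tensor⟩

instance : GradedMonoid.GOne EvenEnd := ⟨EvenEnd.one⟩

/-- The tensor product makes `⨁ X, EvenEnd X` a unital ring. -/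
noncomputable instance : DirectSum.GRing EvenEnd where
  mul_zero {X Y} a := by
    have := EvenEnd.tensor_smul 0 a (0 : EvenEnd Y)
    rwa [zero_smul, zero_smul] at this
  zero_mul {X Y} b := by
    have := EvenEnd.smul_tensor 0 (0 : EvenEnd X) b
    rwa [zero_smul, zero_smul] at this
  mul_add a b c := Subtype.ext (tensor_add a.1 b.1 c.1)
  add_mul a b c := Subtype.ext (add_tensor a.1 b.1 c.1)
  one_mul a := EvenEnd.one_tensor a.2
  mul_one a := EvenEnd.tensor_one a.2
  mul_assoc a b c := EvenEnd.tensor_assoc a.2 b.2 c.2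
  natCast n := n • EvenEnd.one
  natCast_zero := zero_nsmul _
  natCast_succ n := succ_nsmul _ n
  intCast z := z • EvenEnd.one
  intCast_ofNat n := natCast_zsmul _ n
  intCast_negSucc_ofNat n := negSucc_zsmul _ n

theorem EvenEnd.smul_one_tensor {X : Obj} (r : ℂ) (f : EvenEnd X) :
    GradedMonoid.mk (0 + X) (EvenEnd.tensor (r • EvenEnd.one) f) = GradedMonoid.mk X (r • f) := by
  rw [EvenEnd.smul_tensor, ← GradedMonoid.smul_mk, EvenEnd.one_tensor, GradedMonoid.smul_mk]

theorem EvenEnd.tensor_smul_one {X : Obj} (r : ℂ) (f : EvenEnd X) :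
    GradedMonoid.mk (X + 0) (EvenEnd.tensor f (r • EvenEnd.one)) = GradedMonoid.mk X (r • f) := by
  rw [EvenEnd.tensor_smul, ← GradedMonoid.smul_mk, EvenEnd.tensor_one, GradedMonoid.smul_mk]

/-- `⨁ X, EvenEnd X` is a `ℂ`-algebra. -/
noncomputable instance : DirectSum.GAlgebra ℂ EvenEnd where
  toFun :=
    { toFun := fun r => r • EvenEnd.one
      map_zero' := zero_smul _ _
      map_add' := fun r s => add_smul r s _ }
  map_one := one_smul _ _
  map_mul r s := by
    refine Eq.trans ?_ (EvenEnd.smul_one_tensor r (s • EvenEnd.one)).symm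
    rw [← mul_smul]
    rfl
  commutes r x := (EvenEnd.smul_one_tensor r x.2).trans (EvenEnd.tensor_smul_one r x.2).symm
  smul_def r x := (EvenEnd.smul_one_tensor r x.2).symm

/-- The generators `fg - gf` of the ideal defining the even trace: `f : X ⟶ Y` and `g : Y ⟶ X` are
homogeneous of the same degree, so that both composites are even. -/
inductive TraceRel : (⨁ X, EvenEnd X) → (⨁ X, EvenEnd X) → Prop
  | comm {p : ZMod 2} {X Y : Obj} (f : X ⟶ Y) (g : Y ⟶ X)
      (hf : f ∈ homog p X Y) (hg : g ∈ homog p Y X)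
      (hfg : f ≫ g ∈ homog 0 X X) (hgf : g ≫ f ∈ homog 0 Y Y) :
      TraceRel (DirectSum.of EvenEnd X ⟨f ≫ g, hfg⟩) (DirectSum.of EvenEnd Y ⟨g ≫ f, hgf⟩)

/-- The even trace of the twisted Heisenberg category, the quotient of the algebra
`⨁ X, EvenEnd X` by the two-sided ideal generated by all `fg - gf`. The product `x * y` is given by
placing the diagram of `y` to the right of the diagram of `x`. -/
abbrev EvenTrace : Type := RingQuot TraceRel

/-- The class in the even trace of an even endomorphism of `X`. -/
noncomputable def trClass (X : Obj) (f : X ⟶ X) (hf : f ∈ homog 0 X X) : EvenTrace :=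
  RingQuot.mkAlgHom ℂ TraceRel (DirectSum.of EvenEnd X (⟨f, hf⟩ : EvenEnd X))

/-! ## Strands with solid dots and bubbles -/

/-- The solid dot on an upward strand: the right curl. -/
def solidP : ([P] : Obj) ⟶ [P] := mk Diagram.rightCurl

/-- The solid dot on a downward strand: the solid dot on an upward strand, rotated by a half
turn. -/
def solidQ : ([Q] : Obj) ⟶ [Q] :=
  (tensor (mk Diagram.cupQP : ([] : Obj) ⟶ [Q, P]) (𝟙 ([Q] : Obj)) : ([Q] : Obj) ⟶ [Q, P, Q]) ≫
    (tensor (𝟙 ([Q] : Obj)) (tensor solidP (𝟙 ([Q] : Obj))) : ([Q, P, Q] : Obj) ⟶ [Q, P, Q]) ≫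
      (tensor (𝟙 ([Q] : Obj)) (mk Diagram.capPQ : ([P, Q] : Obj) ⟶ []) :
        ([Q, P, Q] : Obj) ⟶ [Q])

/-- An upward strand carrying `k` solid dots. -/
def dotsP : ℕ → (([P] : Obj) ⟶ [P])
  | 0 => 𝟙 _
  | k + 1 => dotsP k ≫ solidP

/-- A downward strand carrying `k` solid dots. -/
def dotsQ : ℕ → (([Q] : Obj) ⟶ [Q])
  | 0 => 𝟙 _
  | k + 1 => dotsQ k ≫ solidQ

/-- The clockwise bubble carrying `k` solid dots on its right-hand (downward) side. -/
def cwBubble (k : ℕ) : ([] : Obj) ⟶ [] :=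
  (mk Diagram.cupPQ : ([] : Obj) ⟶ [P, Q]) ≫
    (tensor (𝟙 ([P] : Obj)) (dotsQ k) : ([P, Q] : Obj) ⟶ [P, Q]) ≫
      (mk Diagram.capPQ : ([P, Q] : Obj) ⟶ [])

theorem mk_even {X Y : Obj} {t : Diagram X Y} (ht : Diagram.IsHomog 0 t) :
    (mk t : X ⟶ Y) ∈ homog 0 X Y := ⟨t, ht, rfl⟩

theorem solidP_even : solidP ∈ homog 0 [P] [P] :=
  even_comp (X := [P]) (Y := [P, P, Q]) (Z := [P])
    (even_comp (X := [P]) (Y := [P, P, Q]) (Z := [P, P, Q])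
      (even_tensor (homog_id [P]) (mk_even .cupPQ))
      (even_tensor (mk_even .cross) (homog_id [Q])))
    (even_tensor (homog_id [P]) (mk_even .capPQ))

theorem solidQ_even : solidQ ∈ homog 0 [Q] [Q] :=
  even_comp (X := [Q]) (Y := [Q, P, Q]) (Z := [Q])
    (even_tensor (mk_even .cupQP) (homog_id [Q]))
    (even_comp (X := [Q, P, Q]) (Y := [Q, P, Q]) (Z := [Q])
      (even_tensor (homog_id [Q]) (even_tensor solidP_even (homog_id [Q])))
      (even_tensor (homog_id [Q]) (mk_even .capPQ)))

theorem dotsP_even : ∀ k : ℕ, dotsP k ∈ homog 0 [P] [P]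
  | 0 => homog_id _
  | k + 1 => even_comp (dotsP_even k) solidP_even

theorem dotsQ_even : ∀ k : ℕ, dotsQ k ∈ homog 0 [Q] [Q]
  | 0 => homog_id _
  | k + 1 => even_comp (dotsQ_even k) solidQ_even

theorem cwBubble_even (k : ℕ) : cwBubble k ∈ homog 0 [] [] :=
  even_comp (X := []) (Y := [P, Q]) (Z := []) (mk_even .cupPQ)
    (even_comp (X := [P, Q]) (Y := [P, Q]) (Z := [])
      (even_tensor (homog_id [P]) (dotsQ_even k)) (mk_even .capPQ))

/-- The class `h₁ ⊗ x₁ᵏ` of an upward strand with `k` solid dots in the even trace. -/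
noncomputable def up (k : ℕ) : EvenTrace := trClass [P] (dotsP k) (dotsP_even k)

/-- The class `h₋₁ ⊗ x₁ᵏ` of a downward strand with `k` solid dots in the even trace. -/
noncomputable def down (k : ℕ) : EvenTrace := trClass [Q] (dotsQ k) (dotsQ_even k)

/-- The class `d k` of the clockwise bubble with `k` solid dots in the even trace. -/
noncomputable def d (k : ℕ) : EvenTrace := trClass [] (cwBubble k) (cwBubble_even k)

/-- The class of the diagram consisting of an upward strand with `k` solid dots and, to its right,
a clockwise bubble with `l` solid dots. -/
noncomputable def upBubble (k l : ℕ) : EvenTrace :=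
  trClass [P] (tensor (dotsP k) (cwBubble l) : ([P] : Obj) ⟶ [P])
    (even_tensor (dotsP_even k) (cwBubble_even l))

/-- The class of the diagram consisting of a clockwise bubble with `l` solid dots and, to its right,
a downward strand with `k` solid dots. -/
noncomputable def bubbleDown (l k : ℕ) : EvenTrace :=
  trClass [Q] (tensor (cwBubble l) (dotsQ k) : ([Q] : Obj) ⟶ [Q])
    (even_tensor (cwBubble_even l) (dotsQ_even k))

end TwistedHeisenberg

namespace TwistedHeisenberg

open Strand

/-! ## The monoidal calculus -/

/-! Write `x`, `c`, `s` for the solid dot, the hollow dot and the upward crossing. A clockwise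
bubble with dots `x^k` to the left of an upward strand is rewritten by resolving the identity of
`QP` between the bubble and the strand (`closure_whisker`). The double crossing gives the partial
trace of `s x^k s`, with the dots on the left strand between the crossings; the two cup-cap terms
merge the bubble into the strand and give `x^k` and `c x^k c`. For `k = 2n` these are equal, because
`c` anticommutes with `x` (`hollowP_solidP`).

Next the dots are moved through the crossings by the dot-crossing relation
(`leftP_solidP_crossing`), whose error terms are `1` and a pair of hollow dots. The main term is the
bubble on the right of the strand. Each of the `k` error positions yields a partial trace of `x^j s`
and its conjugate by `c`; expanding that partial trace once more gives `x^(j+1)` minus strands with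
smaller bubbles (`ptrace_pow_mul`, `ptrace_conj_pow`). Under a trace, conjugation by `c` is
invisible, whence a factor `2`, and terms with an odd bubble vanish (`trace_ptrace_conj_pow`). The
coefficient of `x^(2n)` is thus `2 + 2 * 2n`. Bubbles with an odd number of dots are zero
(`closure_dotsP_odd`), and counting the repetitions of the even ones gives `2 + 4a`
(`sum_sum_range_two_mul`).

For the downward strand no new computation is needed: the half turn `mate` reverses composition up
to a Koszul sign and exchanges the two sides of a strand, so a trace composed with it is again a
trace, and the same bubble slide applies with the opposite overall sign. -/

/-- Super interchange law for morphisms. -/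
theorem tensor_comp_tensor {p q : ZMod 2} {X Y Z X' Y' Z' : Obj} {h : X ⟶ Y} (k : X' ⟶ Y')
    (f : Y ⟶ Z) {g : Y' ⟶ Z'} (hg : g ∈ homog p Y' Z') (hh : h ∈ homog q X Y) :
    tensor h k ≫ tensor f g = Diagram.koszul p q • tensor (h ≫ f) (k ≫ g) := by
  obtain ⟨g, hg, rfl⟩ := hg
  obtain ⟨h, hh, rfl⟩ := hh
  rcases f with ⟨f⟩; rcases k with ⟨k⟩
  exact mk_eq (.interchange f g h k hg hh)

theorem tensor_id_id (X Y : Obj) : tensor (𝟙 X) (𝟙 Y) = 𝟙 (X ++ Y) :=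
  mk_eq (.tensor_id X Y)

theorem koszul_zero_left (q : ZMod 2) : Diagram.koszul 0 q = 1 := by simp [Diagram.koszul]

theorem koszul_zero_right (q : ZMod 2) : Diagram.koszul q 0 = 1 := by simp [Diagram.koszul]

theorem koszul_one_one : Diagram.koszul 1 1 = -1 := by simp [Diagram.koszul]

/-- Every morphism is the sum of an even and an odd one. -/
theorem exists_homog_add {X Y : Obj} (f : X ⟶ Y) :
    ∃ g ∈ homog 0 X Y, ∃ h ∈ homog 1 X Y, f = g + h := by
  obtain ⟨t, rfl⟩ : ∃ t, mk t = f := Quotient.exists_rep f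
  have even {X Y : Obj} {t : Diagram X Y} (ht : Diagram.IsHomog 0 t) :
      ∃ g ∈ homog 0 X Y, ∃ h ∈ homog 1 X Y, mk t = g + h :=
    ⟨_, ⟨t, ht, rfl⟩, 0, zero_mem _, (add_zero _).symm⟩
  have odd {X Y : Obj} {t : Diagram X Y} (ht : Diagram.IsHomog 1 t) :
      ∃ g ∈ homog 0 X Y, ∃ h ∈ homog 1 X Y, mk t = g + h :=
    ⟨0, zero_mem _, _, ⟨t, ht, rfl⟩, (zero_add _).symm⟩
  induction t with
  | id X => exact even (.id X)
  | @comp X Y Z s t hs ht =>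
    obtain ⟨s₀, hs₀, s₁, hs₁, hs⟩ := hs
    obtain ⟨t₀, ht₀, t₁, ht₁, ht⟩ := ht
    refine ⟨t₀ ≫ s₀ + t₁ ≫ s₁, add_mem (homog_comp ht₀ hs₀) (homog_comp ht₁ hs₁),
      t₀ ≫ s₁ + t₁ ≫ s₀, add_mem (homog_comp ht₀ hs₁) (homog_comp ht₁ hs₀), ?_⟩
    refine (congrArg₂ (fun (u : X ⟶ Y) (v : Y ⟶ Z) => u ≫ v) ht hs).trans ?_
    simp only [Preadditive.add_comp, Preadditive.comp_add]
    abel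
  | tensor s t hs ht =>
    obtain ⟨s₀, hs₀, s₁, hs₁, hs⟩ := hs
    obtain ⟨t₀, ht₀, t₁, ht₁, ht⟩ := ht
    refine ⟨TwistedHeisenberg.tensor s₀ t₀ + TwistedHeisenberg.tensor s₁ t₁,
      add_mem (homog_tensor hs₀ ht₀) (homog_tensor hs₁ ht₁),
      TwistedHeisenberg.tensor s₀ t₁ + TwistedHeisenberg.tensor s₁ t₀,
      add_mem (homog_tensor hs₀ ht₁) (homog_tensor hs₁ ht₀), ?_⟩
    change TwistedHeisenberg.tensor (mk s : _ ⟶ _) (mk t : _ ⟶ _) = _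
    rw [hs, ht]
    simp only [add_tensor, tensor_add]
    abel
  | zero X Y => exact even (.zero 0 X Y)
  | @add X Y s t hs ht =>
    obtain ⟨s₀, hs₀, s₁, hs₁, hs⟩ := hs
    obtain ⟨t₀, ht₀, t₁, ht₁, ht⟩ := ht
    refine ⟨s₀ + t₀, add_mem hs₀ ht₀, s₁ + t₁, add_mem hs₁ ht₁, ?_⟩
    change (mk s : X ⟶ Y) + (mk t : X ⟶ Y) = _
    rw [hs, ht]
    abel
  | @smul X Y r t ht =>
    obtain ⟨t₀, ht₀, t₁, ht₁, ht⟩ := ht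
    refine ⟨r • t₀, Submodule.smul_mem _ r ht₀, r • t₁, Submodule.smul_mem _ r ht₁, ?_⟩
    exact (congrArg (fun u : X ⟶ Y => r • u) ht).trans (smul_add r t₀ t₁)
  | dotP => exact odd .dotP
  | dotQ => exact odd .dotQ
  | cross => exact even .cross
  | cupQP => exact even .cupQP
  | cupPQ => exact even .cupPQ
  | capPQ => exact even .capPQ
  | capQP => exact even .capQP

/-- The interchange sign involves only the lower left and the upper right factor. If one is even,
the other need not be homogeneous: it splits into an even and an odd part, and neither produces a
sign. -/
theorem tensor_comp_tensor_of_even_left {X Y Z X' Y' Z' : Obj} {h : X ⟶ Y} (k : X' ⟶ Y')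
    (f : Y ⟶ Z) (g : Y' ⟶ Z') (hh : h ∈ homog 0 X Y) :
    tensor h k ≫ tensor f g = tensor (h ≫ f) (k ≫ g) := by
  obtain ⟨g₀, hg₀, g₁, hg₁, rfl⟩ := exists_homog_add g
  simp only [tensor_add, Preadditive.comp_add, tensor_comp_tensor _ _ hg₀ hh,
    tensor_comp_tensor _ _ hg₁ hh, koszul_zero_right, one_smul]

theorem tensor_comp_tensor_of_even_right {X Y Z X' Y' Z' : Obj} (h : X ⟶ Y) (k : X' ⟶ Y')
    (f : Y ⟶ Z) {g : Y' ⟶ Z'} (hg : g ∈ homog 0 Y' Z') :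
    tensor h k ≫ tensor f g = tensor (h ≫ f) (k ≫ g) := by
  obtain ⟨h₀, hh₀, h₁, hh₁, rfl⟩ := exists_homog_add h
  simp only [add_tensor, Preadditive.add_comp, tensor_comp_tensor _ _ hg hh₀,
    tensor_comp_tensor _ _ hg hh₁, koszul_zero_left, one_smul]

theorem heq_mk_cast {X Y X' Y' : Obj} (hX : X = X') (hY : Y = Y') (f : Diagram X Y) :
    (mk (Diagram.cast hX hY f) : X' ⟶ Y') ≍ (mk f : X ⟶ Y) := by
  subst hX hY; rfl

/-- Strictness identifies words that are equal but not definitionally so for variable words;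
heterogeneous equality carries this until `whisker` absorbs it. -/
theorem tensor_assoc_heq {X Y X' Y' X'' Y'' : Obj} (f : X ⟶ Y) (g : X' ⟶ Y') (h : X'' ⟶ Y'') :
    tensor (tensor f g) h ≍ tensor f (tensor g h) := by
  rcases f with ⟨f⟩; rcases g with ⟨g⟩; rcases h with ⟨h⟩
  exact (heq_mk_cast (List.append_assoc X X' X'') (List.append_assoc Y Y' Y'') _).symm.trans
    (heq_of_eq (mk_eq (.tensor_assoc f g h)))

theorem unit_tensor_heq {X Y : Obj} (f : X ⟶ Y) : tensor (𝟙 ([] : Obj)) f ≍ f := by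
  rcases f with ⟨f⟩
  exact (heq_mk_cast (List.nil_append X) (List.nil_append Y) _).symm.trans
    (heq_of_eq (mk_eq (.unit_tensor f)))

theorem tensor_unit_heq {X Y : Obj} (f : X ⟶ Y) : tensor f (𝟙 ([] : Obj)) ≍ f := by
  rcases f with ⟨f⟩
  exact (heq_mk_cast (List.append_nil X) (List.append_nil Y) _).symm.trans
    (heq_of_eq (mk_eq (.tensor_unit f)))

theorem tensor_heq {X Y X' Y' A B A' B' : Obj} {f : X ⟶ Y} {g : X' ⟶ Y'} {f' : A ⟶ B}
    {g' : A' ⟶ B'} (h₁ : X = A) (h₂ : Y = B) (h₃ : X' = A') (h₄ : Y' = B') (hf : f ≍ f')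
    (hg : g ≍ g') : tensor f g ≍ tensor f' g' := by
  subst h₁ h₂ h₃ h₄
  rw [eq_of_heq hf, eq_of_heq hg]

/-! ### Whiskering: local diagrams inside wider ones. -/

/-- The diagram `f` with vertical strands `a` on its left and `b` on its right. The source and
target are recorded separately, so that they can be kept in normal form. -/
def whisker (a b : Obj) {X Y : Obj} (f : X ⟶ Y) (S T : Obj)
    (hS : S = a ++ (X ++ b) := by first | rfl | simp)
    (hT : T = a ++ (Y ++ b) := by first | rfl | simp) : S ⟶ T :=
  eqToHom hS ≫ tensor (𝟙 a) (tensor f (𝟙 b)) ≫ eqToHom hT.symm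

section Whisker

variable {a b X Y Z S M T : Obj}

theorem whisker_heq (f : X ⟶ Y) (hS : S = a ++ (X ++ b)) (hT : T = a ++ (Y ++ b)) :
    whisker a b f S T hS hT ≍ tensor (𝟙 a) (tensor f (𝟙 b)) := by
  subst hS hT; simp [whisker]

theorem whisker_nil_nil (f : X ⟶ Y) (hX hY) : whisker [] [] f X Y hX hY = f :=
  eq_of_heq ((whisker_heq f hX hY).trans ((unit_tensor_heq _).trans (tensor_unit_heq f)))

theorem whisker_nil_left (f : X ⟶ Y) :
    whisker [] b f (X ++ b) (Y ++ b) = tensor f (𝟙 b) :=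
  eq_of_heq ((whisker_heq f rfl rfl).trans (unit_tensor_heq _))

theorem whisker_nil_right (f : X ⟶ Y) :
    whisker a [] f (a ++ X) (a ++ Y) = tensor (𝟙 a) f :=
  eq_of_heq ((whisker_heq f (by simp) (by simp)).trans
    (tensor_heq rfl rfl (by simp) (by simp) HEq.rfl (tensor_unit_heq f)))

theorem whisker_id (hS hT) : whisker a b (𝟙 X) S S hS hT = 𝟙 S := by
  subst hS; simp [whisker, tensor_id_id]

theorem whisker_add (f g : X ⟶ Y) (hS hT) :
    whisker a b (f + g) S T hS hT = whisker a b f S T hS hT + whisker a b g S T hS hT := by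
  subst hS hT; simp [whisker, add_tensor, tensor_add]

theorem whisker_smul (r : ℂ) (f : X ⟶ Y) (hS hT) :
    whisker a b (r • f) S T hS hT = r • whisker a b f S T hS hT := by
  subst hS hT; simp [whisker, smul_tensor, tensor_smul]

theorem whisker_neg (f : X ⟶ Y) (hS hT) :
    whisker a b (-f) S T hS hT = -whisker a b f S T hS hT := by
  rw [← neg_one_smul ℂ f, whisker_smul, neg_one_smul]

theorem whisker_comp (f : X ⟶ Y) (g : Y ⟶ Z) (hS hM hT) :
    whisker a b (f ≫ g) S T hS hT = whisker a b f S M hS hM ≫ whisker a b g M T hM hT := by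
  subst hS hM hT
  simp only [whisker, eqToHom_refl, Category.id_comp, Category.comp_id]
  rw [tensor_comp_tensor_of_even_left _ _ _ (homog_id _),
    tensor_comp_tensor_of_even_right _ _ _ (homog_id _), Category.id_comp, Category.id_comp]

/-- Makes one layer of whiskers a normal form: a relation proved on few strands is whiskered by
`congrArg` and then flattened, so that it rewrites inside a larger diagram. -/
theorem whisker_whisker {a' b' : Obj} {S' T' : Obj} (f : X ⟶ Y) (hS' hT' hS hT) :
    whisker a b (whisker a' b' f S' T' hS' hT') S T hS hT =
      whisker (a ++ a') (b' ++ b) f S T (by simp [hS, hS']) (by simp [hT, hT']) := by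
  refine eq_of_heq ((whisker_heq _ _ _).trans (.trans ?_ (whisker_heq _ _ _).symm))
  have h₁ := tensor_heq (g := 𝟙 b) hS' hT' rfl rfl (whisker_heq f hS' hT') HEq.rfl
  have h₂ := (h₁.trans (tensor_assoc_heq _ _ _)).trans
    (tensor_heq rfl rfl (List.append_assoc X b' b) (List.append_assoc Y b' b) HEq.rfl
      (tensor_assoc_heq _ _ _))
  rw [tensor_id_id] at h₂
  have h₃ := tensor_heq (f := 𝟙 a) rfl rfl (by simp [hS']) (by simp [hT']) HEq.rfl h₂
  have h₄ := h₃.trans (tensor_assoc_heq _ _ _).symm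
  rwa [tensor_id_id] at h₄

theorem whisker_mem {p : ZMod 2} {f : X ⟶ Y} (hf : f ∈ homog p X Y) (hS hT) :
    whisker a b f S T hS hT ∈ homog p S T := by
  subst hS hT
  have := homog_tensor (homog_id a) (homog_tensor hf (homog_id b))
  simpa [whisker] using this

/-- Brings the right-hand diagram into the bracketing where `Y` is a tensor slot of its own, as
needed to interchange it with a diagram ending in `Y`. -/
theorem whisker_append (a Y b c : Obj) {X' Y' : Obj} (g : X' ⟶ Y') (hS hT) :
    whisker (a ++ (Y ++ b)) c g (a ++ (Y ++ (b ++ (X' ++ c)))) (a ++ (Y ++ (b ++ (Y' ++ c)))) hS hT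
      = tensor (𝟙 a) (tensor (𝟙 Y) (tensor (𝟙 b) (tensor g (𝟙 c)))) := by
  refine eq_of_heq ((whisker_heq _ _ _).trans ?_)
  rw [← tensor_id_id a, ← tensor_id_id Y]
  exact (tensor_assoc_heq _ _ _).trans
    (tensor_heq rfl rfl (by simp) (by simp) HEq.rfl (tensor_assoc_heq _ _ _))

/-- Distant diagrams supercommute. -/
theorem whisker_exchange {p q : ZMod 2} {X' Y' a c r l : Obj} {f : X ⟶ Y} {g : X' ⟶ Y'}
    (b l' r' M' : Obj) (hf : f ∈ homog p X Y) (hg : g ∈ homog q X' Y') {hS hM hM₂ hT}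
    (hr : r = b ++ (X' ++ c)) (hl : l = a ++ (Y ++ b)) (hr' : r' = b ++ (Y' ++ c))
    (hl' : l' = a ++ (X ++ b)) (hM' : M' = a ++ (X ++ (b ++ (Y' ++ c)))) :
    whisker a r f S M hS hM ≫ whisker l c g M T hM₂ hT =
      Diagram.koszul q p • (whisker l' c g S M' (by simp [hS, hl', hr]) (by simp [hM', hl']) ≫
        whisker a r' f M' T (by simp [hM', hr']) (by simp [hT, hl, hr'])) := by
  obtain rfl : T = a ++ (Y ++ (b ++ (Y' ++ c))) := by simp [hT, hl]
  subst hr hl hr' hl' hM' hS hM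
  have hG : tensor (𝟙 b) (tensor g (𝟙 c)) ∈ homog q (b ++ (X' ++ c)) (b ++ (Y' ++ c)) := by
    simpa using homog_tensor (homog_id b) (homog_tensor hg (homog_id c))
  have e (r : Obj) : whisker a r f (a ++ (X ++ r)) (a ++ (Y ++ r)) =
      tensor (𝟙 a) (tensor f (𝟙 r)) := by simp [whisker]
  rw [whisker_append, whisker_append, e, e,
    tensor_comp_tensor_of_even_left _ _ _ (homog_id _),
    tensor_comp_tensor_of_even_left _ _ _ (homog_id _), tensor_comp_tensor _ _ hG hf,
    tensor_comp_tensor_of_even_left _ _ _ (homog_id _), Category.id_comp, Category.id_comp,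
    Category.id_comp, Category.comp_id, Category.comp_id, tensor_smul]

/-- Distant diagrams commute if the sign is trivial: the one on the right is moved down. -/
theorem whisker_comm {p q : ZMod 2} {X' Y' a c r l : Obj} {f : X ⟶ Y} {g : X' ⟶ Y'}
    (b l' r' M' : Obj) (hf : f ∈ homog p X Y) (hg : g ∈ homog q X' Y') {hS hM hM₂ hT}
    (hk : Diagram.koszul q p = 1)
    (hr : r = b ++ (X' ++ c)) (hl : l = a ++ (Y ++ b)) (hr' : r' = b ++ (Y' ++ c))
    (hl' : l' = a ++ (X ++ b)) (hM' : M' = a ++ (X ++ (b ++ (Y' ++ c)))) :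
    whisker a r f S M hS hM ≫ whisker l c g M T hM₂ hT =
      whisker l' c g S M' (by simp [hS, hl', hr]) (by simp [hM', hl']) ≫
        whisker a r' f M' T (by simp [hM', hr']) (by simp [hT, hl, hr']) := by
  rw [whisker_exchange b l' r' M' hf hg hr hl hr' hl' hM', hk, one_smul]

theorem whisker_comm_assoc {p q : ZMod 2} {X' Y' a c r l U : Obj} {f : X ⟶ Y} {g : X' ⟶ Y'}
    (b l' r' M' : Obj) (hf : f ∈ homog p X Y) (hg : g ∈ homog q X' Y') {hS hM hM₂ hT} {k : T ⟶ U}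
    (hk : Diagram.koszul q p = 1)
    (hr : r = b ++ (X' ++ c)) (hl : l = a ++ (Y ++ b)) (hr' : r' = b ++ (Y' ++ c))
    (hl' : l' = a ++ (X ++ b)) (hM' : M' = a ++ (X ++ (b ++ (Y' ++ c)))) :
    whisker a r f S M hS hM ≫ whisker l c g M T hM₂ hT ≫ k =
      whisker l' c g S M' (by simp [hS, hl', hr]) (by simp [hM', hl']) ≫
        whisker a r' f M' T (by simp [hM', hr']) (by simp [hT, hl, hr']) ≫ k := by
  rw [← Category.assoc, whisker_comm b l' r' M' hf hg hk hr hl hr' hl' hM', Category.assoc]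

/-- Distant diagrams commute if the sign is trivial: the one on the left is moved down. -/
theorem whisker_comm' {p q : ZMod 2} {X' Y' a c r' l' M' : Obj} {f : X ⟶ Y} {g : X' ⟶ Y'}
    (b l r M : Obj) (hf : f ∈ homog p X Y) (hg : g ∈ homog q X' Y') {hS hM' hM₂ hT}
    (hk : Diagram.koszul q p = 1)
    (hr : r = b ++ (X' ++ c)) (hl : l = a ++ (Y ++ b)) (hr' : r' = b ++ (Y' ++ c))
    (hl' : l' = a ++ (X ++ b)) (hM : M = a ++ (Y ++ (b ++ (X' ++ c)))) :
    whisker l' c g S M' hS hM' ≫ whisker a r' f M' T hM₂ hT =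
      whisker a r f S M (by simp [hS, hl', hr]) (by simp [hM, hr]) ≫
        whisker l c g M T (by simp [hM, hl]) (by simp [hT, hl, hr']) :=
  (whisker_comm b l' r' M' hf hg hk hr hl hr' hl' (by simp [hM', hl'])).symm

theorem whisker_comm'_assoc {p q : ZMod 2} {X' Y' a c r' l' M' U : Obj} {f : X ⟶ Y} {g : X' ⟶ Y'}
    (b l r M : Obj) (hf : f ∈ homog p X Y) (hg : g ∈ homog q X' Y') {hS hM' hM₂ hT} {k : T ⟶ U}
    (hk : Diagram.koszul q p = 1)
    (hr : r = b ++ (X' ++ c)) (hl : l = a ++ (Y ++ b)) (hr' : r' = b ++ (Y' ++ c))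
    (hl' : l' = a ++ (X ++ b)) (hM : M = a ++ (Y ++ (b ++ (X' ++ c)))) :
    whisker l' c g S M' hS hM' ≫ whisker a r' f M' T hM₂ hT ≫ k =
      whisker a r f S M (by simp [hS, hl', hr]) (by simp [hM, hr]) ≫
        whisker l c g M T (by simp [hM, hl]) (by simp [hT, hl, hr']) ≫ k := by
  rw [← Category.assoc, whisker_comm' b l r M hf hg hk hr hl hr' hl' hM, Category.assoc]

/-- The middle word is determined here, unlike in `whisker_comp`, so `simp` can use it. -/
theorem whisker_comp' (f : X ⟶ Y) (g : Y ⟶ Z) (hS hT) :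
    whisker a b (f ≫ g) S T hS hT =
      whisker a b f S (a ++ (Y ++ b)) hS rfl ≫ whisker a b g (a ++ (Y ++ b)) T rfl hT :=
  whisker_comp f g hS rfl hT

end Whisker

/-! ## Generators and local relations -/

/-- The upward crossing. -/
def crossing : ([P, P] : Obj) ⟶ [P, P] := mk Diagram.cross

/-- The hollow dot on an upward strand. -/
def hollowP : ([P] : Obj) ⟶ [P] := mk Diagram.dotP

/-- The hollow dot on a downward strand. -/
def hollowQ : ([Q] : Obj) ⟶ [Q] := mk Diagram.dotQ

/-- The cup `1 ⟶ PQ`. -/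
def cupPQ : ([] : Obj) ⟶ [P, Q] := mk Diagram.cupPQ

/-- The cup `1 ⟶ QP`. -/
def cupQP : ([] : Obj) ⟶ [Q, P] := mk Diagram.cupQP

/-- The cap `PQ ⟶ 1`. -/
def capPQ : ([P, Q] : Obj) ⟶ [] := mk Diagram.capPQ

/-- The cap `QP ⟶ 1`. -/
def capQP : ([Q, P] : Obj) ⟶ [] := mk Diagram.capQP

/-- The crossing `PQ ⟶ QP`. -/
def crossingPQ : ([P, Q] : Obj) ⟶ [Q, P] := mk Diagram.crossPQ

/-- The crossing `QP ⟶ PQ`. -/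
def crossingQP : ([Q, P] : Obj) ⟶ [P, Q] := mk Diagram.crossQP

theorem crossing_mem : crossing ∈ homog 0 _ _ := mk_even .cross
theorem hollowP_mem : hollowP ∈ homog 1 _ _ := ⟨_, .dotP, rfl⟩
theorem hollowQ_mem : hollowQ ∈ homog 1 _ _ := ⟨_, .dotQ, rfl⟩
theorem cupPQ_mem : cupPQ ∈ homog 0 _ _ := mk_even .cupPQ
theorem cupQP_mem : cupQP ∈ homog 0 _ _ := mk_even .cupQP
theorem capPQ_mem : capPQ ∈ homog 0 _ _ := mk_even .capPQ
theorem capQP_mem : capQP ∈ homog 0 _ _ := mk_even .capQP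

theorem solidP_eq : solidP = whisker [P] [] cupPQ [P] [P, P, Q] ≫
    whisker [] [Q] crossing [P, P, Q] [P, P, Q] ≫ whisker [P] [] capPQ [P, P, Q] [P] := by
  rw [show whisker [P] [] cupPQ [P] [P, P, Q] = tensor (𝟙 [P]) cupPQ from whisker_nil_right _,
    show whisker [] [Q] crossing [P, P, Q] [P, P, Q] = tensor crossing (𝟙 [Q]) from
      whisker_nil_left _,
    show whisker [P] [] capPQ [P, P, Q] [P] = tensor (𝟙 [P]) capPQ from whisker_nil_right _,
    ← Category.assoc]
  rfl

theorem crossingPQ_eq : crossingPQ = whisker [] [P, Q] cupQP [P, Q] [Q, P, P, Q] ≫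
    whisker [Q] [Q] crossing [Q, P, P, Q] [Q, P, P, Q] ≫
      whisker [Q, P] [] capPQ [Q, P, P, Q] [Q, P] := by
  rw [show whisker [] [P, Q] cupQP [P, Q] [Q, P, P, Q] = tensor cupQP (𝟙 [P, Q]) from
      whisker_nil_left _,
    show whisker [Q, P] [] capPQ [Q, P, P, Q] [Q, P] = tensor (𝟙 [Q, P]) capPQ from
      whisker_nil_right _, ← Category.assoc]
  simp only [whisker, eqToHom_refl, Category.id_comp, Category.comp_id]
  rfl

theorem crossingQP_eq : crossingQP = whisker [Q, P] [] cupPQ [Q, P] [Q, P, P, Q] ≫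
    whisker [Q] [Q] crossing [Q, P, P, Q] [Q, P, P, Q] ≫
      whisker [] [P, Q] capQP [Q, P, P, Q] [P, Q] := by
  rw [show whisker [] [P, Q] capQP [Q, P, P, Q] [P, Q] = tensor capQP (𝟙 [P, Q]) from
      whisker_nil_left _,
    show whisker [Q, P] [] cupPQ [Q, P] [Q, P, P, Q] = tensor (𝟙 [Q, P]) cupPQ from
      whisker_nil_right _, ← Category.assoc]
  simp only [whisker, eqToHom_refl, Category.id_comp, Category.comp_id]
  rfl

theorem crossingPQ_mem : crossingPQ ∈ homog 0 _ _ := by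
  rw [crossingPQ_eq]
  exact even_comp (whisker_mem cupQP_mem _ _)
    (even_comp (whisker_mem crossing_mem _ _) (whisker_mem capPQ_mem _ _))

/-- `cupQP` and `capPQ` straighten on an upward strand. -/
theorem zigzag_capPQ_P : whisker [P] [] cupQP [P] [P, Q, P] ≫ whisker [] [P] capPQ [P, Q, P] [P] =
    𝟙 ([P] : Obj) := by
  rw [show whisker [P] [] cupQP [P] [P, Q, P] = tensor (𝟙 [P]) cupQP from whisker_nil_right _,
    show whisker [] [P] capPQ [P, Q, P] [P] = tensor capPQ (𝟙 [P]) from whisker_nil_left _]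
  exact mk_eq .zigzag₁

theorem zigzag_capQP_P : whisker [] [P] cupPQ [P] [P, Q, P] ≫ whisker [P] [] capQP [P, Q, P] [P] =
    𝟙 ([P] : Obj) := by
  rw [show whisker [] [P] cupPQ [P] [P, Q, P] = tensor cupPQ (𝟙 [P]) from whisker_nil_left _,
    show whisker [P] [] capQP [P, Q, P] [P] = tensor (𝟙 [P]) capQP from whisker_nil_right _]
  exact mk_eq .zigzag₂

theorem zigzag_capPQ_Q : whisker [] [Q] cupQP [Q] [Q, P, Q] ≫ whisker [Q] [] capPQ [Q, P, Q] [Q] =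
    𝟙 ([Q] : Obj) := by
  rw [show whisker [] [Q] cupQP [Q] [Q, P, Q] = tensor cupQP (𝟙 [Q]) from whisker_nil_left _,
    show whisker [Q] [] capPQ [Q, P, Q] [Q] = tensor (𝟙 [Q]) capPQ from whisker_nil_right _]
  exact mk_eq .zigzag₄

theorem crossing_crossing : crossing ≫ crossing = 𝟙 _ := mk_eq .cross_cross

theorem braid : whisker [] [P] crossing [P, P, P] [P, P, P] ≫
    whisker [P] [] crossing [P, P, P] [P, P, P] ≫ whisker [] [P] crossing [P, P, P] [P, P, P] =
    whisker [P] [] crossing [P, P, P] [P, P, P] ≫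
      whisker [] [P] crossing [P, P, P] [P, P, P] ≫
        whisker [P] [] crossing [P, P, P] [P, P, P] := by
  rw [show whisker [] [P] crossing [P, P, P] [P, P, P] = tensor crossing (𝟙 [P]) from
      whisker_nil_left _,
    show whisker [P] [] crossing [P, P, P] [P, P, P] = tensor (𝟙 [P]) crossing from
      whisker_nil_right _]
  simp only [← Category.assoc]
  exact mk_eq .braid

theorem hollow_crossing_left : whisker [] [P] hollowP [P, P] [P, P] ≫ crossing =
    crossing ≫ whisker [P] [] hollowP [P, P] [P, P] := by
  rw [show whisker [] [P] hollowP [P, P] [P, P] = tensor hollowP (𝟙 [P]) from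
      whisker_nil_left _,
    show whisker [P] [] hollowP [P, P] [P, P] = tensor (𝟙 [P]) hollowP from
      whisker_nil_right _]
  exact mk_eq .dot_cross_left

theorem hollow_crossing_right : whisker [P] [] hollowP [P, P] [P, P] ≫ crossing =
    crossing ≫ whisker [] [P] hollowP [P, P] [P, P] := by
  rw [show whisker [] [P] hollowP [P, P] [P, P] = tensor hollowP (𝟙 [P]) from
      whisker_nil_left _,
    show whisker [P] [] hollowP [P, P] [P, P] = tensor (𝟙 [P]) hollowP from
      whisker_nil_right _]
  exact mk_eq .dot_cross_right

theorem hollow_capPQ : whisker [P] [] hollowQ [P, Q] [P, Q] ≫ capPQ =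
    whisker [] [Q] hollowP [P, Q] [P, Q] ≫ capPQ := by
  rw [show whisker [P] [] hollowQ [P, Q] [P, Q] = tensor (𝟙 [P]) hollowQ from
      whisker_nil_right _,
    show whisker [] [Q] hollowP [P, Q] [P, Q] = tensor hollowP (𝟙 [Q]) from
      whisker_nil_left _]
  exact mk_eq (.symm .dot_capPQ)

theorem hollow_cupPQ : cupPQ ≫ whisker [P] [] hollowQ [P, Q] [P, Q] =
    -(cupPQ ≫ whisker [] [Q] hollowP [P, Q] [P, Q]) := by
  rw [show whisker [P] [] hollowQ [P, Q] [P, Q] = tensor (𝟙 [P]) hollowQ from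
      whisker_nil_right _,
    show whisker [] [Q] hollowP [P, Q] [P, Q] = tensor hollowP (𝟙 [Q]) from
      whisker_nil_left _, eq_neg_iff_add_eq_zero, add_comm, ← eq_neg_iff_add_eq_zero]
  exact mk_eq .dot_cupPQ

theorem hollow_hollow : hollowP ≫ hollowP = 𝟙 _ := mk_eq .dotP_dotP

/-- Resolution of the identity of `QP`. -/
theorem id_QP : 𝟙 ([Q, P] : Obj) = crossingQP ≫ crossingPQ + capQP ≫ cupQP +
    whisker [Q] [] hollowP [Q, P] [Q, P] ≫ capQP ≫ cupQP ≫
      whisker [Q] [] hollowP [Q, P] [Q, P] := by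
  let u : ([Q, P] : Obj) ⟶ [Q, P] := tensor (𝟙 [Q]) hollowP
  let v : ([Q, P] : Obj) ⟶ [Q, P] := tensor hollowQ (𝟙 [P])
  have h : crossingQP ≫ crossingPQ = 𝟙 ([Q, P] : Obj) + (-1 : ℂ) • (capQP ≫ cupQP) +
      (-1 : ℂ) • ((u ≫ capQP) ≫ cupQP ≫ v) :=
    mk_eq .crossPQ_crossQP
  -- The defining relation has its upper hollow dot on the downward strand; this cup lets it pass to
  -- the upward strand without sign.
  have h' : cupQP ≫ v = cupQP ≫ u := mk_eq .dot_cupQP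
  rw [show whisker [Q] [] hollowP [Q, P] [Q, P] = u from whisker_nil_right _, h, h',
    Category.assoc, neg_one_smul, neg_one_smul]
  abel

/-! ## Sliding a strand out of a cap or a cup -/

/-- Unfolding the rotated crossing exposes its cap `QP`. The given cup is moved up past the other
cup and the crossing until it meets this cap, and the zigzag straightens. `pitchfork_capPQ` is the
analogue for caps. -/
theorem pitchfork_cupPQ : whisker [] [P] cupPQ [P] [P, Q, P] ≫
    whisker [P] [] crossingQP [P, Q, P] [P, P, Q] =
      whisker [P] [] cupPQ [P] [P, P, Q] ≫ whisker [] [Q] crossing [P, P, Q] [P, P, Q] := by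
  have z := congrArg (fun f => whisker [] [P, Q] f [P, P, Q] [P, P, Q] rfl rfl) zigzag_capQP_P
  simp only [whisker_comp', whisker_whisker, whisker_id] at z
  dsimp only [List.cons_append, List.nil_append] at z
  simp only [crossingQP_eq, whisker_comp', whisker_whisker]
  dsimp only [List.cons_append, List.nil_append]
  rw [whisker_comm_assoc [P] [P] [P, P, Q] [P, P, Q] cupPQ_mem cupPQ_mem,
    whisker_comm_assoc [] [] [P, P, Q] [P, P, Q] cupPQ_mem crossing_mem, z, Category.comp_id] <;> rfl

theorem pitchfork_capPQ : whisker [P] [] crossingPQ [P, P, Q] [P, Q, P] ≫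
    whisker [] [P] capPQ [P, Q, P] [P] =
      whisker [] [Q] crossing [P, P, Q] [P, P, Q] ≫ whisker [P] [] capPQ [P, P, Q] [P] := by
  have z := congrArg (fun f => whisker [] [P, Q] f [P, P, Q] [P, P, Q] rfl rfl) zigzag_capPQ_P
  simp only [whisker_comp', whisker_whisker, whisker_id] at z
  dsimp only [List.cons_append, List.nil_append] at z
  simp only [crossingPQ_eq, whisker_comp', whisker_whisker]
  dsimp only [List.cons_append, List.nil_append, Category.assoc]
  simp only [Category.assoc]
  rw [whisker_comm' [P] [P] [P, P, Q] [P, P, Q] capPQ_mem capPQ_mem,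
    whisker_comm'_assoc [] [] [P, P, Q] [P, P, Q] capPQ_mem crossing_mem, ← Category.assoc, z,
    Category.id_comp] <;> rfl

/-! ### Partial traces, closures and the dot-crossing relation. -/

/-- The right partial trace of an endomorphism of `PP`. -/
def ptrace (f : ([P, P] : Obj) ⟶ [P, P]) : ([P] : Obj) ⟶ [P] :=
  whisker [P] [] cupPQ [P] [P, P, Q] ≫ whisker [] [Q] f [P, P, Q] [P, P, Q] ≫
    whisker [P] [] capPQ [P, P, Q] [P]

/-- The clockwise closure of an endomorphism of `P`. -/
def closure (f : ([P] : Obj) ⟶ [P]) : ([] : Obj) ⟶ [] :=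
  cupPQ ≫ whisker [] [Q] f [P, Q] [P, Q] ≫ capPQ

/-- The endomorphism of `PP` given by `f` on the left strand. -/
def leftP (f : ([P] : Obj) ⟶ [P]) : ([P, P] : Obj) ⟶ [P, P] := whisker [] [P] f [P, P] [P, P]

/-- The endomorphism of `PP` given by `f` on the right strand. -/
def rightP (f : ([P] : Obj) ⟶ [P]) : ([P, P] : Obj) ⟶ [P, P] := whisker [P] [] f [P, P] [P, P]

/-- The identity of `QP`, formed by the downward side of the bubble and the strand next to it, is
resolved by `id_QP`. The pitchforks turn the double crossing into a partial trace; in the cup-cap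
terms two zigzags merge bubble and strand. -/
theorem closure_whisker (f : ([P] : Obj) ⟶ [P]) (hf : f ∈ homog 0 [P] [P]) :
    whisker [] [P] (closure f) [P] [P] =
      ptrace (crossing ≫ leftP f ≫ crossing) + f + hollowP ≫ f ≫ hollowP := by
  have i := congrArg (fun f => whisker [P] [] f [P, Q, P] [P, Q, P] rfl rfl) id_QP
  have b := congrArg (fun f => whisker [] [] f [P] [P] rfl rfl) zigzag_capPQ_P
  have b' := congrArg (fun f => whisker [] [] f [P] [P] rfl rfl) zigzag_capQP_P
  simp only [whisker_add, whisker_id, whisker_comp', whisker_whisker] at i b b'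
  dsimp only [List.cons_append, List.nil_append] at i b b'
  have p := pitchfork_cupPQ
  have p' := pitchfork_capPQ
  simp only [closure, ptrace, leftP, whisker_comp', whisker_whisker]
  dsimp only [List.cons_append, List.nil_append]
  rw [← Category.id_comp (whisker [] [Q, P] f _ _ _ _), i]
  simp only [Preadditive.add_comp, Preadditive.comp_add, Category.assoc]
  congr 1
  · congr 1
    · rw [reassoc_of% p, whisker_comm'_assoc [] [P] [P, Q] [P, P, Q] hf crossingPQ_mem, p'] <;> rfl
    · rw [reassoc_of% b', whisker_comm'_assoc [] [P] [] [P] hf cupQP_mem, b, Category.comp_id,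
        whisker_nil_nil] <;> rfl
  -- The lower hollow dot slides below the cup and the upper one above the cap, so they end up on
  -- either side of `f`.
  · rw [whisker_comm_assoc [] [] [P] [P] cupPQ_mem hollowP_mem, reassoc_of% b',
      whisker_comm'_assoc [Q] [P, Q] [Q, P] [P, Q, P] hf hollowP_mem,
      whisker_comm' [] [] [P] [P] capPQ_mem hollowP_mem,
      whisker_comm'_assoc [] [P] [] [P] hf cupQP_mem, reassoc_of% b, whisker_nil_nil,
      whisker_nil_nil] <;> rfl

/-- The solid dot on the left strand of two, in terms of the partial trace of a braid. -/
theorem leftP_solidP : leftP solidP = whisker [P, P] [] cupPQ [P, P] [P, P, P, Q] ≫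
      whisker [P] [Q] crossing [P, P, P, Q] [P, P, P, Q] ≫
        whisker [] [P, Q] crossing [P, P, P, Q] [P, P, P, Q] ≫
          whisker [P] [Q] crossing [P, P, P, Q] [P, P, P, Q] ≫
            whisker [P, P] [] capPQ [P, P, P, Q] [P, P] + crossing +
      rightP hollowP ≫ crossing ≫ rightP hollowP := by
  have i := congrArg (fun f => whisker [P, P] [] f [P, P, Q, P] [P, P, Q, P] rfl rfl) id_QP
  have b := congrArg (fun f => whisker [P] [] f [P, P] [P, P] rfl rfl) zigzag_capPQ_P
  have b' := congrArg (fun f => whisker [P] [] f [P, P] [P, P] rfl rfl) zigzag_capQP_P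
  have p := congrArg (fun f => whisker [P] [] f [P, P] [P, P, P, Q] rfl rfl) pitchfork_cupPQ
  have p' := congrArg (fun f => whisker [P] [] f [P, P, P, Q] [P, P] rfl rfl) pitchfork_capPQ
  simp only [whisker_add, whisker_id, whisker_comp', whisker_whisker] at i b b' p p'
  dsimp only [List.cons_append, List.nil_append] at i b b' p p'
  simp only [leftP, rightP, solidP_eq, whisker_comp', whisker_whisker]
  dsimp only [List.cons_append, List.nil_append]
  -- As in `closure_whisker`, with the downward part of the curl in place of the side of the bubble.
  rw [← Category.id_comp (whisker [] [Q, P] crossing _ _ _ _), i]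
  simp only [Preadditive.add_comp, Preadditive.comp_add, Category.assoc]
  congr 1
  · congr 1
    · rw [reassoc_of% p, whisker_comm'_assoc [] [P, P] [P, Q] [P, P, P, Q] crossing_mem
        crossingPQ_mem, p'] <;> rfl
    · rw [reassoc_of% b', whisker_comm'_assoc [] [P, P] [] [P, P] crossing_mem cupQP_mem, b,
        Category.comp_id, whisker_nil_nil] <;> rfl
  · rw [whisker_comm_assoc [] [P] [P] [P, P] cupPQ_mem hollowP_mem, reassoc_of% b',
      whisker_comm'_assoc [Q] [P, P, Q] [Q, P] [P, P, Q, P] crossing_mem hollowP_mem,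
      whisker_comm' [] [P] [P] [P, P] capPQ_mem hollowP_mem,
      whisker_comm'_assoc [] [P, P] [] [P, P] crossing_mem cupQP_mem, reassoc_of% b,
      whisker_nil_nil] <;> rfl

theorem leftP_hollowP_crossing :
    leftP hollowP ≫ crossing = crossing ≫ rightP hollowP := hollow_crossing_left

theorem rightP_hollowP_crossing :
    rightP hollowP ≫ crossing = crossing ≫ leftP hollowP := hollow_crossing_right

/-- Stack a crossing on `leftP_solidP`. In the braid term it slides under the cap; the braid
relation and `s² = 1` leave one crossing below a right curl. In the other two terms the crossings
cancel, giving `1` and the pair of hollow dots. -/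
theorem leftP_solidP_crossing : leftP solidP ≫ crossing =
    crossing ≫ rightP solidP + 𝟙 _ + rightP hollowP ≫ leftP hollowP := by
  have br := congrArg (fun f => whisker [] [Q] f [P, P, P, Q] [P, P, P, Q] rfl rfl) braid
  have ss := congrArg (fun f => whisker [] [P, Q] f [P, P, P, Q] [P, P, P, Q] rfl rfl)
    crossing_crossing
  simp only [whisker_id, whisker_comp', whisker_whisker] at br ss
  dsimp only [List.cons_append, List.nil_append] at br ss
  have w : whisker [] [] crossing [P, P] [P, P] = crossing := whisker_nil_nil _ _ _
  rw [leftP_solidP]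
  simp only [Preadditive.add_comp, Category.assoc]
  rw [crossing_crossing, rightP_hollowP_crossing, reassoc_of% crossing_crossing]
  congr 2
  rw [rightP, solidP_eq]
  simp only [whisker_comp', whisker_whisker]
  dsimp only [List.cons_append, List.nil_append]
  -- The first three occurrences belong to the braid; the fourth is the bare crossing on top, which
  -- must be a whisker to be exchanged with the cap.
  nth_rw 4 [← w]
  rw [whisker_comm' [] [P, P] [P, Q] [P, P, P, Q] crossing_mem capPQ_mem, ← reassoc_of% br,
    reassoc_of% ss, whisker_comm'_assoc [] [P, P] [] [P, P] crossing_mem cupPQ_mem, w] <;> rfl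

/-- The hollow dot travels once around the curl: through the crossing, over the cap, under the cup,
through the crossing again. Only the cup `PQ` contributes a sign. -/
theorem hollowP_solidP : hollowP ≫ solidP = -(solidP ≫ hollowP) := by
  have l := congrArg (fun f => whisker [] [Q] f [P, P, Q] [P, P, Q] rfl rfl) hollow_crossing_left
  have r := congrArg (fun f => whisker [] [Q] f [P, P, Q] [P, P, Q] rfl rfl) hollow_crossing_right
  have b := congrArg (fun f => whisker [P] [] f [P, P, Q] [P] rfl rfl) hollow_capPQ
  have b' := congrArg (fun f => whisker [P] [] f [P] [P, P, Q] rfl rfl) hollow_cupPQ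
  simp only [whisker_neg, whisker_comp', whisker_whisker] at l r b b'
  dsimp only [List.cons_append, List.nil_append] at l r b b'
  have w : whisker [] [] hollowP [P] [P] = hollowP := whisker_nil_nil _ _ _
  rw [solidP_eq, ← w]
  simp only [Category.assoc]
  rw [whisker_comm_assoc [] [P] [P, Q] [P, P, Q] hollowP_mem cupPQ_mem, reassoc_of% l, ← b,
    whisker_comm_assoc [] [P, P] [Q] [P, P, Q] crossing_mem hollowQ_mem, reassoc_of% b',
    Preadditive.neg_comp, Category.assoc, reassoc_of% r,
    whisker_comm [] [P] [] [P] hollowP_mem capPQ_mem] <;> rfl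

theorem ptrace_crossing : ptrace crossing = solidP := solidP_eq.symm

theorem ptrace_add (f g : ([P, P] : Obj) ⟶ [P, P]) : ptrace (f + g) = ptrace f + ptrace g := by
  simp [ptrace, whisker_add]

/-- The left strand is not closed up, so what it carries slides freely past the even cup on its
right. -/
theorem ptrace_leftP_comp {p : ZMod 2} {f : ([P] : Obj) ⟶ [P]} (hf : f ∈ homog p [P] [P])
    (g : ([P, P] : Obj) ⟶ [P, P]) : ptrace (leftP f ≫ g) = f ≫ ptrace g := by
  simp only [ptrace, leftP, whisker_comp', whisker_whisker]
  dsimp only [List.cons_append, List.nil_append]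
  rw [Category.assoc, whisker_comm'_assoc [] [P] [] [P] hf cupPQ_mem, whisker_nil_nil] <;> rfl

theorem ptrace_comp_leftP {p : ZMod 2} {f : ([P] : Obj) ⟶ [P]} (hf : f ∈ homog p [P] [P])
    (g : ([P, P] : Obj) ⟶ [P, P]) : ptrace (g ≫ leftP f) = ptrace g ≫ f := by
  simp only [ptrace, leftP, whisker_comp', whisker_whisker]
  dsimp only [List.cons_append, List.nil_append]
  simp only [Category.assoc]
  rw [whisker_comm [] [P] [] [P] hf capPQ_mem, whisker_nil_nil] <;> rfl

theorem ptrace_rightP (f : ([P] : Obj) ⟶ [P]) :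
    ptrace (rightP f) = whisker [P] [] (closure f) [P] [P] := by
  simp only [ptrace, rightP, closure, whisker_comp', whisker_whisker]
  rfl

theorem leftP_comp (f g : ([P] : Obj) ⟶ [P]) : leftP (f ≫ g) = leftP f ≫ leftP g :=
  whisker_comp f g _ _ _

theorem rightP_comp (f g : ([P] : Obj) ⟶ [P]) : rightP (f ≫ g) = rightP f ≫ rightP g :=
  whisker_comp f g _ _ _

theorem leftP_comp_rightP {p q : ZMod 2} {f g : ([P] : Obj) ⟶ [P]} (hf : f ∈ homog p [P] [P])
    (hg : g ∈ homog q [P] [P]) (h : Diagram.koszul q p = 1) :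
    leftP f ≫ rightP g = rightP g ≫ leftP f :=
  whisker_comm [] [P] [P] [P, P] hf hg h rfl rfl rfl rfl rfl

/-! ## Rotation of upward strands to downward strands -/

/-- The rotation by a half turn of an endomorphism of `P`. -/
def mate (f : ([P] : Obj) ⟶ [P]) : ([Q] : Obj) ⟶ [Q] :=
  whisker [] [Q] cupQP [Q] [Q, P, Q] ≫ whisker [Q] [Q] f [Q, P, Q] [Q, P, Q] ≫
    whisker [Q] [] capPQ [Q, P, Q] [Q]

theorem mate_mem {p : ZMod 2} {f : ([P] : Obj) ⟶ [P]} (hf : f ∈ homog p [P] [P]) :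
    mate f ∈ homog p [Q] [Q] := by
  have := homog_comp (whisker_mem (a := []) (b := [Q]) (S := [Q]) (T := [Q, P, Q])
    cupQP_mem rfl rfl) (homog_comp
    (whisker_mem (a := [Q]) (b := [Q]) (S := [Q, P, Q]) (T := [Q, P, Q]) hf rfl rfl)
    (whisker_mem (a := [Q]) (b := []) (S := [Q, P, Q]) (T := [Q]) capPQ_mem rfl rfl))
  rwa [add_zero, zero_add] at this

theorem mate_id : mate (𝟙 _) = 𝟙 _ := by
  rw [mate, whisker_id, Category.id_comp, zigzag_capPQ_Q]

theorem mate_add (f g : ([P] : Obj) ⟶ [P]) : mate (f + g) = mate f + mate g := by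
  simp [mate, whisker_add]

theorem mate_smul (r : ℂ) (f : ([P] : Obj) ⟶ [P]) : mate (r • f) = r • mate f := by
  simp [mate, whisker_smul]

theorem mate_solidP : mate solidP = solidQ := by
  rw [mate, show whisker [] [Q] cupQP [Q] [Q, P, Q] = tensor cupQP (𝟙 [Q]) from
      whisker_nil_left _,
    show whisker [Q] [] capPQ [Q, P, Q] [Q] = tensor (𝟙 [Q]) capPQ from whisker_nil_right _]
  simp only [whisker, eqToHom_refl, Category.id_comp, Category.comp_id]
  rfl

/-- Rotation reverses the order of composition. -/
theorem mate_comp {p q : ZMod 2} {f g : ([P] : Obj) ⟶ [P]} (hf : f ∈ homog p [P] [P])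
    (hg : g ∈ homog q [P] [P]) :
    mate (f ≫ g) = Diagram.koszul q p • (mate g ≫ mate f) := by
  have z := congrArg (fun f => whisker [Q] [Q] f [Q, P, Q] [Q, P, Q] rfl rfl) zigzag_capPQ_P
  simp only [whisker_comp', whisker_id, whisker_whisker] at z
  dsimp only [List.cons_append, List.nil_append] at z
  have e : whisker [Q] [Q] (f ≫ g) [Q, P, Q] [Q, P, Q] =
      whisker [Q] [Q] f [Q, P, Q] [Q, P, Q] ≫ whisker [Q] [Q] g [Q, P, Q] [Q, P, Q] :=
    whisker_comp f g _ _ _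
  rw [mate, mate, mate, e]
  simp only [Category.assoc]
  -- A zigzag is inserted between `f` and `g`, which puts them on different strands.
  conv_lhs => rw [← Category.id_comp (whisker [Q] [Q] g _ _ _ _), ← z]
  simp only [Category.assoc]
  rw [whisker_comm_assoc [] [Q, P, Q] [P, Q] [Q, P, Q, P, Q] capPQ_mem hg,
    whisker_comm [] [Q, P, Q] [] [Q, P, Q] capPQ_mem capPQ_mem,
    whisker_comm_assoc [] [Q, P] [Q, P, Q] [Q, P, Q, P, Q] hf cupQP_mem,
    ← Category.assoc (whisker [Q] [Q, P, Q] f _ _ _ _),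
    -- Here `f` and `g` exchange heights; all other exchanges involve an even cup or cap, so this is
    -- the only source of a sign.
    whisker_exchange [Q] [Q, P, Q] [Q, P, Q] [Q, P, Q, P, Q] hf hg]
  · simp only [Linear.smul_comp, Linear.comp_smul, Category.assoc]
    rw [whisker_comm_assoc [Q] [Q, P, Q] [Q] [Q, P, Q] hf capPQ_mem,
      whisker_comm_assoc [] [] [Q, P, Q] [Q, P, Q] cupQP_mem cupQP_mem,
      whisker_comm_assoc [Q] [Q] [Q, P, Q] [Q, P, Q] cupQP_mem hg,
      whisker_comm_assoc [Q] [Q] [Q] [Q] cupQP_mem capPQ_mem] <;>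
    first | rfl | exact koszul_zero_left _ | exact koszul_zero_right _
  all_goals first | rfl | exact koszul_zero_left _ | exact koszul_zero_right _

/-- The region to the left of the middle strand of the zigzag opens upward, to the right of the
resulting downward strand; the closed diagram leaves through it. -/
theorem mate_whisker_left (y : ([] : Obj) ⟶ []) (hy : y ∈ homog 0 [] []) :
    mate (whisker [] [P] y [P] [P]) = whisker [Q] [] y [Q] [Q] := by
  simp only [mate, whisker_whisker]
  dsimp only [List.cons_append, List.nil_append]
  rw [whisker_comm [] [Q] [] [Q] hy capPQ_mem, reassoc_of% zigzag_capPQ_Q] <;> rfl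

theorem mate_whisker_right (y : ([] : Obj) ⟶ []) (hy : y ∈ homog 0 [] []) :
    mate (whisker [P] [] y [P] [P]) = whisker [] [Q] y [Q] [Q] := by
  simp only [mate, whisker_whisker]
  dsimp only [List.cons_append, List.nil_append]
  rw [whisker_comm_assoc [] [] [Q] [Q] cupQP_mem hy, zigzag_capPQ_Q, Category.comp_id] <;> rfl

/-- Straightening the zigzag of `mate f` against the cap carries `f` over the cap. This moves the
dots of a bubble to its upward side. -/
theorem whisker_mate_capPQ {f : ([P] : Obj) ⟶ [P]} (hf : f ∈ homog 0 [P] [P]) :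
    whisker [P] [] (mate f) [P, Q] [P, Q] ≫ capPQ =
      whisker [] [Q] f [P, Q] [P, Q] ≫ capPQ := by
  have z := congrArg (fun f => whisker [] [Q] f [P, Q] [P, Q] rfl rfl) zigzag_capPQ_P
  have w : whisker [] [] capPQ [P, Q] [] = capPQ := whisker_nil_nil _ _ _
  simp only [whisker_comp', whisker_id, whisker_whisker] at z
  dsimp only [List.cons_append, List.nil_append] at z
  rw [mate, ← w]
  simp only [whisker_comp', whisker_whisker]
  dsimp only [List.cons_append, List.nil_append]
  simp only [Category.assoc]
  rw [whisker_comm' [] [] [P, Q] [P, Q] capPQ_mem capPQ_mem,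
    whisker_comm'_assoc [] [] [P, Q] [P, Q] capPQ_mem hf, reassoc_of% z] <;> rfl

/-! ## The dot-crossing relation and partial traces -/

/-- Moving `k` copies of `a` past `s`. -/
theorem mul_pow_eq_pow_mul_add_sum {R : Type*} [Ring R] {s a b e : R} (h : s * a = b * s + e)
    (k : ℕ) : s * a ^ k = b ^ k * s + ∑ j ∈ Finset.range k, b ^ j * e * a ^ (k - 1 - j) := by
  induction k with
  | zero => simp
  | succ k ih =>
    rw [pow_succ, ← mul_assoc, ih, add_mul, mul_assoc (b ^ k), h, Finset.sum_range_succ,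
      Finset.sum_mul, mul_add, ← mul_assoc, ← pow_succ, add_assoc]
    congr 1
    rw [add_comm]
    congr 1
    · refine Finset.sum_congr rfl fun j hj => ?_
      rw [mul_assoc, ← pow_succ]
      congr 2
      have := Finset.mem_range.1 hj
      omega
    · simp

section PartialTrace

variable {A B V : Type*} [Ring A] [Ring B] [AddCommGroup V] [Module ℂ V] {l r : A →+* B}
  {t : B →+ A} {s : B} {x c : A} {π : A →+ V}

/-- In the application `A` and `B` are the endomorphism rings of `P` and `PP`, `l` and `r` act on
the left and right strand, `t` is the partial trace and `π` a trace. Dots on the closed strand are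
moved through `s` to the open strand, where they leave `t`; each error term contains a bubble. -/
theorem ptrace_pow_mul (hx : s * l x = r x * s + (1 + l c * r c)) (hs : t s = x)
    (hcx : Commute (l c) (r x)) (htx : ∀ b, t (b * l x) = t b * x)
    (htc : ∀ b, t (l c * b) = c * t b) (j : ℕ) :
    t (r x ^ j * s) = x ^ (j + 1) - ∑ i ∈ Finset.range j,
      (t (r x ^ i) * x ^ (j - 1 - i) + c * t (r x ^ i * r c) * x ^ (j - 1 - i)) := by
  have htx' (b : B) (m : ℕ) : t (b * l x ^ m) = t b * x ^ m := by
    induction m with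
    | zero => simp
    | succ m ih => rw [pow_succ, ← mul_assoc, htx, ih, mul_assoc, ← pow_succ]
  rw [eq_sub_of_add_eq (mul_pow_eq_pow_mul_add_sum hx j).symm, map_sub, htx', hs, ← pow_succ',
    map_sum]
  congr 1
  refine Finset.sum_congr rfl fun i _ => ?_
  rw [htx', mul_add, mul_one, map_add, ← mul_assoc, ← (hcx.pow_right i).eq, mul_assoc, htc,
    add_mul]

/-- The main term loses both crossings by `s * s = 1`. In an error term with hollow dots, `r c`
passes the remaining `s` and becomes `l c`, so the two hollow dots leave the partial trace on
opposite sides. -/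
theorem ptrace_conj_pow (ss : s * s = 1) (hx : s * l x = r x * s + (1 + l c * r c))
    (hc : s * l c = r c * s) (hxx : Commute (l x) (r x)) (hcx : Commute (l c) (r x))
    (hxc : Commute (l x) (r c)) (htx : ∀ b, t (l x * b) = x * t b)
    (htc : ∀ b, t (l c * b) = c * t b) (htc' : ∀ b, t (b * l c) = t b * c) (k : ℕ) :
    t (s * l x ^ k * s) = t (r x ^ k) + ∑ j ∈ Finset.range k,
      (x ^ (k - 1 - j) * t (r x ^ j * s) + c * x ^ (k - 1 - j) * t (r x ^ j * s) * c) := by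
  have htx' (b : B) (m : ℕ) : t (l x ^ m * b) = x ^ m * t b := by
    induction m with
    | zero => simp
    | succ m ih => rw [pow_succ', mul_assoc, htx, ih, pow_succ', mul_assoc]
  rw [mul_pow_eq_pow_mul_add_sum hx k, add_mul, mul_assoc, ss, mul_one, map_add, Finset.sum_mul,
    map_sum]
  congr 1
  refine Finset.sum_congr rfl fun j _ => ?_
  generalize k - 1 - j = m
  have h₁ : r x ^ j * l x ^ m = l x ^ m * r x ^ j := ((hxx.pow_pow m j).eq).symm
  have h₂ : r x ^ j * (l c * r c) * l x ^ m * s = l c * (l x ^ m * (r x ^ j * s * l c)) :=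
    calc
      _ = (r x ^ j * l c) * (r c * l x ^ m) * s := by simp only [mul_assoc]
      _ = (l c * r x ^ j) * (l x ^ m * r c) * s := by
        rw [(hcx.pow_right j).eq, (hxc.pow_left m).eq]
      _ = l c * (r x ^ j * l x ^ m) * (r c * s) := by simp only [mul_assoc]
      _ = _ := by rw [h₁, ← hc]; simp only [mul_assoc]
  rw [mul_add, mul_one, add_mul, add_mul, map_add, h₁, mul_assoc, htx', h₂, htc, htx', htc']
  simp only [mul_assoc]

theorem trace_ptrace_conj_pow (ss : s * s = 1) (hx : s * l x = r x * s + (1 + l c * r c))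
    (hc : s * l c = r c * s) (hs : t s = x) (hxx : Commute (l x) (r x))
    (hcx : Commute (l c) (r x)) (hxc : Commute (l x) (r c)) (htx : ∀ b, t (l x * b) = x * t b)
    (htx' : ∀ b, t (b * l x) = t b * x)
    (htc : ∀ b, t (l c * b) = c * t b) (htc' : ∀ b, t (b * l c) = t b * c)
    (hπ : ∀ m j, π (c * x ^ m * t (r x ^ j * s) * c) = π (x ^ m * t (r x ^ j * s)))
    (hπ' : ∀ m i n, π (x ^ m * (c * t (r x ^ i * r c) * x ^ n)) = 0)
    (hd : ∀ i, Commute (t (r x ^ i)) x) (k : ℕ) :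
    π (t (s * l x ^ k * s)) = π (t (r x ^ k)) + (2 * k : ℂ) • π (x ^ k) -
      ∑ j ∈ Finset.range k, ∑ i ∈ Finset.range j,
        (2 : ℂ) • π (x ^ (k - 2 - i) * t (r x ^ i)) := by
  rw [ptrace_conj_pow ss hx hc hxx hcx hxc htx htc htc', map_add, map_sum, add_sub_assoc]
  congr 1
  have h (j) (hj : j ∈ Finset.range k) :
      π (x ^ (k - 1 - j) * t (r x ^ j * s) + c * x ^ (k - 1 - j) * t (r x ^ j * s) * c) =
        (2 : ℂ) • π (x ^ k) - ∑ i ∈ Finset.range j,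
          (2 : ℂ) • π (x ^ (k - 2 - i) * t (r x ^ i)) := by
    have hj := Finset.mem_range.1 hj
    rw [map_add, hπ, ← two_smul ℂ, ptrace_pow_mul hx hs hcx htx' htc, mul_sub, ← pow_add,
      show k - 1 - j + (j + 1) = k by omega, map_sub, smul_sub, Finset.mul_sum, map_sum,
      Finset.smul_sum]
    congr 1
    -- Since `i < j < k`, none of the natural number subtractions is truncated.
    refine Finset.sum_congr rfl fun i hi => ?_
    have hi := Finset.mem_range.1 hi
    rw [mul_add, map_add, hπ', add_zero, ((hd i).pow_right _).eq, ← mul_assoc, ← pow_add,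
      show k - 1 - j + (j - 1 - i) = k - 2 - i by omega]
  rw [Finset.sum_congr rfl h, Finset.sum_sub_distrib, Finset.sum_const, Finset.card_range,
    ← Nat.cast_smul_eq_nsmul ℂ, smul_smul, mul_comm (2 : ℂ)]

/-- The index `i = 2b` occurs for the `2n - 1 - 2b` values of `j` above it. Twice this number is `2
+ 4(n - 1 - b)`, and `a = n - 1 - b`. -/
theorem sum_sum_range_two_mul {f : ℕ → V} (hf : ∀ i, f (2 * i + 1) = 0) (n : ℕ) :
    ∑ j ∈ Finset.range (2 * n), ∑ i ∈ Finset.range j, (2 : ℂ) • f i =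
      ∑ a ∈ Finset.range n, (2 + 4 * (a : ℂ)) • f (2 * (n - 1 - a)) := by
  have h₀ (n : ℕ) : ∑ i ∈ Finset.range (2 * n), f i = ∑ b ∈ Finset.range n, f (2 * b) := by
    induction n with
    | zero => simp
    | succ n ih =>
      rw [show 2 * (n + 1) = 2 * n + 1 + 1 by ring, Finset.sum_range_succ, Finset.sum_range_succ,
        ih, hf, add_zero, ← Finset.sum_range_succ (fun b => f (2 * b))]
  have h (n : ℕ) : ∑ j ∈ Finset.range (2 * n), ∑ i ∈ Finset.range j, (2 : ℂ) • f i =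
      ∑ b ∈ Finset.range n, (2 + 4 * ((n - 1 - b : ℕ) : ℂ)) • f (2 * b) := by
    induction n with
    | zero => simp
    | succ n ih =>
      rw [show 2 * (n + 1) = 2 * n + 1 + 1 by ring, Finset.sum_range_succ, Finset.sum_range_succ,
        ih, Finset.sum_range_succ _ (2 * n), ← Finset.smul_sum, h₀, Finset.sum_range_succ _ n,
        ← add_assoc, Finset.smul_sum, ← Finset.sum_add_distrib, ← Finset.sum_add_distrib]
      congr 1
      · refine Finset.sum_congr rfl fun b hb => ?_
        have hb := Finset.mem_range.1 hb
        rw [← add_smul, ← add_smul, show n + 1 - 1 - b = n - 1 - b + 1 by omega]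
        congr 1
        push_cast
        ring
      · simp
  rw [h, ← Finset.sum_range_reflect]
  refine Finset.sum_congr rfl fun a ha => ?_
  have ha := Finset.mem_range.1 ha
  rw [show n - 1 - (n - 1 - a) = a by omega]

end PartialTrace

/-! ## Dotted strands and bubbles -/

theorem dotsP_eq_pow (k : ℕ) : dotsP k = (End.of solidP ^ k : End ([P] : Obj)) := by
  induction k with
  | zero => rfl
  | succ k ih => rw [pow_succ', End.mul_def, ← ih]; rfl

theorem dotsQ_eq_pow (k : ℕ) : dotsQ k = (End.of solidQ ^ k : End ([Q] : Obj)) := by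
  induction k with
  | zero => rfl
  | succ k ih => rw [pow_succ', End.mul_def, ← ih]; rfl

theorem mate_dotsP (k : ℕ) : mate (dotsP k) = dotsQ k := by
  induction k with
  | zero => exact mate_id
  | succ k ih =>
    change mate (dotsP k ≫ solidP) = _
    rw [mate_comp (dotsP_even k) solidP_even, koszul_zero_left, one_smul, ih, mate_solidP,
      dotsQ_eq_pow, dotsQ_eq_pow, pow_succ, End.mul_def]

theorem cwBubble_eq_closure (k : ℕ) : cwBubble k = closure (dotsP k) := by
  have h : cwBubble k = cupPQ ≫ whisker [P] [] (dotsQ k) [P, Q] [P, Q] ≫ capPQ := by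
    rw [show whisker [P] [] (dotsQ k) [P, Q] [P, Q] = tensor (𝟙 [P]) (dotsQ k) from
      whisker_nil_right _]
    rfl
  rw [h, ← mate_dotsP, whisker_mate_capPQ (dotsP_even k), closure]

theorem closure_mem {p : ZMod 2} {f : ([P] : Obj) ⟶ [P]} (hf : f ∈ homog p [P] [P]) :
    closure f ∈ homog p [] [] := by
  have := homog_comp cupPQ_mem
    (homog_comp (whisker_mem (a := []) (b := [Q]) (S := [P, Q]) (T := [P, Q]) hf rfl rfl) capPQ_mem)
  rwa [add_zero, zero_add] at this

theorem ptrace_mem {f : ([P, P] : Obj) ⟶ [P, P]} (hf : f ∈ homog 0 [P, P] [P, P]) :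
    ptrace f ∈ homog 0 [P] [P] :=
  even_comp (whisker_mem cupPQ_mem _ _)
    (even_comp (whisker_mem hf _ _) (whisker_mem capPQ_mem _ _))

/-- A hollow dot can be moved around a bubble. -/
theorem closure_hollowP_comp {f : ([P] : Obj) ⟶ [P]} (hf : f ∈ homog 1 [P] [P]) :
    closure (hollowP ≫ f) = closure (f ≫ hollowP) := by
  have e (f g : ([P] : Obj) ⟶ [P]) : whisker [] [Q] (f ≫ g) [P, Q] [P, Q] =
      whisker [] [Q] f [P, Q] [P, Q] ≫ whisker [] [Q] g [P, Q] [P, Q] := whisker_comp f g _ _ _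
  rw [closure, closure, e, e, Category.assoc, Category.assoc, ← hollow_capPQ,
    ← Category.assoc (whisker [] [Q] f _ _ _ _),
    -- Two signs cancel: one from exchanging the hollow dot with the odd `f`, one from the cup `PQ`.
    whisker_exchange [] [P] [Q] [P, Q] hf hollowQ_mem, koszul_one_one,
    neg_one_smul, Preadditive.neg_comp, Preadditive.comp_neg, Category.assoc,
    ← Category.assoc cupPQ, ← Category.assoc cupPQ, hollow_cupPQ, Preadditive.neg_comp, neg_neg] <;> rfl

/-- Central diagrams to the right of a strand. -/
theorem comp_whisker_right {p q : ZMod 2} {f : ([P] : Obj) ⟶ [P]} {y : ([] : Obj) ⟶ []}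
    (hf : f ∈ homog p [P] [P]) (hy : y ∈ homog q [] []) :
    f ≫ whisker [P] [] y [P] [P] = Diagram.koszul q p • (whisker [P] [] y [P] [P] ≫ f) := by
  have := whisker_exchange (a := []) (c := []) (S := [P]) (M := [P]) (T := [P]) [] [P] [] [P] hf hy
    (hS := rfl) (hM := rfl) (hM₂ := rfl) (hT := rfl) rfl rfl rfl rfl rfl
  rwa [whisker_nil_nil] at this

theorem eq_zero_of_eq_neg {V : Type*} [AddCommGroup V] [Module ℂ V] {v : V} (h : v = -v) :
    v = 0 := by
  have h₂ : (2 : ℂ) • v = 0 := by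
    rw [two_smul]; nth_rw 2 [h]; exact add_neg_cancel v
  exact (smul_eq_zero.1 h₂).resolve_left two_ne_zero

theorem hollowP_dotsP_two_mul (n : ℕ) : hollowP ≫ dotsP (2 * n) = dotsP (2 * n) ≫ hollowP := by
  let x : End ([P] : Obj) := solidP
  let c : End ([P] : Obj) := hollowP
  have h : x * c = -(c * x) := hollowP_solidP
  have h₂ : Commute (x ^ 2) c := by
    rw [commute_iff_eq, pow_two, mul_assoc, h, mul_neg, ← mul_assoc, h, neg_mul, neg_neg, mul_assoc]
  have := (h₂.pow_left n).eq
  rwa [← pow_mul, End.mul_def, End.mul_def, ← dotsP_eq_pow] at this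

theorem hollowP_dotsP_odd (n : ℕ) :
    hollowP ≫ dotsP (2 * n + 1) = -(dotsP (2 * n + 1) ≫ hollowP) := by
  change hollowP ≫ dotsP (2 * n) ≫ solidP = -((dotsP (2 * n) ≫ solidP) ≫ hollowP)
  rw [← Category.assoc, hollowP_dotsP_two_mul, Category.assoc, hollowP_solidP, Preadditive.comp_neg,
    Category.assoc]

/-- Insert `c² = 1` and move one hollow dot around the bubble. It returns without sign, but
anticommutes with an odd number of solid dots, so the bubble equals its negative. -/
theorem closure_dotsP_odd (n : ℕ) : closure (dotsP (2 * n + 1)) = 0 := by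
  have h : hollowP ≫ dotsP (2 * n + 1) ∈ homog 1 [P] [P] := by
    simpa using homog_comp hollowP_mem (dotsP_even (2 * n + 1))
  have e := closure_hollowP_comp h
  rw [← Category.assoc, hollow_hollow, Category.id_comp, hollowP_dotsP_odd, Preadditive.neg_comp,
    Category.assoc, hollow_hollow, Category.comp_id] at e
  refine eq_zero_of_eq_neg (e.trans ?_)
  simp [closure, whisker_neg]

/-! ## Sliding a strand through a bubble -/

/-- `leftP` as a ring homomorphism. -/
noncomputable def leftPHom : End ([P] : Obj) →+* End ([P, P] : Obj) :=
  RingHom.mk' ⟨⟨leftP, whisker_id _ _⟩, fun f g => leftP_comp g f⟩ fun f g => whisker_add f g rfl rfl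

/-- `rightP` as a ring homomorphism. -/
noncomputable def rightPHom : End ([P] : Obj) →+* End ([P, P] : Obj) :=
  RingHom.mk' ⟨⟨rightP, whisker_id _ _⟩, fun f g => rightP_comp g f⟩ fun f g => whisker_add f g rfl rfl

/-- `ptrace` as an additive homomorphism. -/
noncomputable def ptraceHom : End ([P, P] : Obj) →+ End ([P] : Obj) :=
  AddMonoidHom.mk' ptrace ptrace_add

/-- Under a trace `π`, pulling the dots out of the partial trace of `crossing ≫ leftP (dotsP k) ≫
crossing` produces solid dots and bubbles only. -/
theorem trace_ptrace_crossing {V : Type*} [AddCommGroup V] [Module ℂ V]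
    (π : (([P] : Obj) ⟶ [P]) →+ V)
    (hπ : ∀ (p : ZMod 2) (f g : ([P] : Obj) ⟶ [P]), f ∈ homog p [P] [P] → g ∈ homog p [P] [P] →
      π (f ≫ g) = π (g ≫ f)) (k : ℕ) :
    π (ptrace (crossing ≫ leftP (dotsP k) ≫ crossing)) =
      π (whisker [P] [] (closure (dotsP k)) [P] [P]) + (2 * k : ℂ) • π (dotsP k) -
      ∑ j ∈ Finset.range k, ∑ i ∈ Finset.range j,
        (2 : ℂ) • π (dotsP (k - 2 - i) ≫ whisker [P] [] (closure (dotsP i)) [P] [P]) := by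
  let x : End ([P] : Obj) := solidP
  let c : End ([P] : Obj) := hollowP
  let s : End ([P, P] : Obj) := crossing
  let π' : End ([P] : Obj) →+ V := π
  have hx (k : ℕ) : dotsP k = x ^ k := dotsP_eq_pow k
  have hr (k : ℕ) : rightPHom x ^ k = rightP (dotsP k) := by
    rw [← map_pow, ← hx]; rfl
  have hl (k : ℕ) : leftPHom x ^ k = leftP (dotsP k) := by
    rw [← map_pow, ← hx]; rfl
  have h₁ : s * s = 1 := crossing_crossing
  have h₂ : s * leftPHom x = rightPHom x * s + (1 + leftPHom c * rightPHom c) :=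
    leftP_solidP_crossing.trans (add_assoc _ _ _)
  have h₃ : s * leftPHom c = rightPHom c * s := leftP_hollowP_crossing
  have h₄ : ptraceHom s = x := ptrace_crossing
  have h₅ : Commute (leftPHom x) (rightPHom x) :=
    (leftP_comp_rightP solidP_even solidP_even rfl).symm
  have h₆ : Commute (leftPHom c) (rightPHom x) :=
    (leftP_comp_rightP hollowP_mem solidP_even rfl).symm
  have h₇ : Commute (leftPHom x) (rightPHom c) :=
    (leftP_comp_rightP solidP_even hollowP_mem rfl).symm
  have h₈ (b) : ptraceHom (leftPHom x * b) = x * ptraceHom b := ptrace_comp_leftP solidP_even b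
  have h₉ (b) : ptraceHom (b * leftPHom x) = ptraceHom b * x := ptrace_leftP_comp solidP_even b
  have h₁₀ (b) : ptraceHom (leftPHom c * b) = c * ptraceHom b := ptrace_comp_leftP hollowP_mem b
  have h₁₁ (b) : ptraceHom (b * leftPHom c) = ptraceHom b * c := ptrace_leftP_comp hollowP_mem b
  have key := trace_ptrace_conj_pow (π := π') h₁ h₂ h₃ h₄ h₅ h₆ h₇ h₈ h₉ h₁₀ h₁₁ ?_ ?_ ?_ k
  · have h (i j : ℕ) : dotsP j ≫ ptrace (rightP (dotsP i)) =
        x ^ j * ptraceHom (rightP (dotsP i)) := by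
      rw [ptrace_rightP, comp_whisker_right (dotsP_even j) (closure_mem (dotsP_even i)),
        koszul_zero_left, one_smul, ← ptrace_rightP, ← hx]
      rfl
    rw [hl] at key
    simp only [hr, ← h] at key
    rw [← hx] at key
    simp only [← ptrace_rightP]
    exact key
  -- Invisibility of conjugation by the hollow dot: the trace property in degree one brings the two
  -- hollow dots together, and `c * c = 1`.
  · intro m j
    rw [hr]
    change π' (c * x ^ m * ptraceHom (End.of (rightP (dotsP j)) * s) * c) = _
    have hT : ptraceHom (End.of (rightP (dotsP j)) * s) ∈ homog 0 [P] [P] :=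
      ptrace_mem (even_comp crossing_mem (whisker_mem (dotsP_even j) _ _))
    generalize ptraceHom (End.of (rightP (dotsP j)) * s) = T at hT ⊢
    have hm : x ^ m * T ∈ homog 0 [P] [P] := even_comp hT (hx m ▸ dotsP_even m)
    have hcm : c * (x ^ m * T) ∈ homog 1 [P] [P] := by
      simpa using homog_comp hm hollowP_mem
    have hcc : c * c = 1 := hollow_hollow
    have e : π' (c * (x ^ m * T) * c) = π' (c * (c * (x ^ m * T))) :=
      hπ 1 c (c * (x ^ m * T)) hollowP_mem hcm
    rw [mul_assoc c, e, ← mul_assoc c c, hcc, one_mul]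
  -- Vanishing of the terms with an odd bubble `W`: it anticommutes with the odd remainder of the
  -- strand, while the trace property lets the two factors be exchanged without sign.
  · intro m i n
    have hD : rightPHom x ^ i * rightPHom c = rightP (hollowP ≫ dotsP i) := by
      rw [hr, rightP_comp]; rfl
    have hy : hollowP ≫ dotsP i ∈ homog 1 [P] [P] := by
      simpa using homog_comp hollowP_mem (dotsP_even i)
    rw [hD, show ptraceHom (rightP (hollowP ≫ dotsP i)) = _ from ptrace_rightP _]
    have hw := closure_mem hy
    generalize closure (hollowP ≫ dotsP i) = y at hw
    have hxm (m) : x ^ m ∈ homog 0 [P] [P] := hx m ▸ dotsP_even m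
    have hf : x ^ n * (x ^ m * c) ∈ homog 1 [P] [P] := by
      simpa using homog_comp (homog_comp hollowP_mem (hxm m)) (hxm n)
    let W : End ([P] : Obj) := whisker [P] [] y [P] [P]
    have hW : W ∈ homog 1 [P] [P] := whisker_mem hw _ _
    have hg : x ^ m * (c * W) ∈ homog 0 [P] [P] :=
      homog_comp (p := 1 + 1) (homog_comp hW hollowP_mem) (hxm m)
    have e₁ : π' (x ^ m * (c * W) * x ^ n) = π' (x ^ n * (x ^ m * (c * W))) :=
      hπ 0 (x ^ n) (x ^ m * (c * W)) (hxm n) hg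
    have e₂ : π' (W * (x ^ n * (x ^ m * c))) = π' (x ^ n * (x ^ m * c) * W) :=
      hπ 1 (x ^ n * (x ^ m * c)) W hf hW
    have e₃ : W * (x ^ n * (x ^ m * c)) = -(x ^ n * (x ^ m * c) * W) := by
      refine (comp_whisker_right hf hw).trans ?_
      rw [koszul_one_one, neg_one_smul]
      rfl
    have e₄ : π' (x ^ n * (x ^ m * c) * W) = 0 := by
      rw [e₃, map_neg] at e₂
      exact eq_zero_of_eq_neg e₂.symm
    change π' (x ^ m * (c * W * x ^ n)) = 0
    rw [← mul_assoc, e₁, ← e₄, mul_assoc, mul_assoc]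
  · intro i
    rw [hr, show ptraceHom (rightP (dotsP i)) = _ from ptrace_rightP _]
    have e := comp_whisker_right solidP_even (closure_mem (dotsP_even i))
    rw [koszul_zero_left, one_smul] at e
    exact e

/-- The bubble slide, in any quotient on which traces are defined. -/
theorem bubble_slide {V : Type*} [AddCommGroup V] [Module ℂ V]
    (π : (([P] : Obj) ⟶ [P]) →+ V)
    (hπ : ∀ (p : ZMod 2) (f g : ([P] : Obj) ⟶ [P]), f ∈ homog p [P] [P] → g ∈ homog p [P] [P] →
      π (f ≫ g) = π (g ≫ f)) (n : ℕ) :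
    π (whisker [] [P] (cwBubble (2 * n)) [P] [P]) - π (whisker [P] [] (cwBubble (2 * n)) [P] [P]) =
      (2 + 4 * (n : ℂ)) • π (dotsP (2 * n)) -
      ∑ a ∈ Finset.range n, (2 + 4 * (a : ℂ)) •
        π (dotsP (2 * a) ≫ whisker [P] [] (cwBubble (2 * (n - 1 - a))) [P] [P]) := by
  simp only [cwBubble_eq_closure]
  have h (i : ℕ) : π (dotsP (2 * n - 2 - (2 * i + 1)) ≫
      whisker [P] [] (closure (dotsP (2 * i + 1))) [P] [P]) = 0 := by
    rw [closure_dotsP_odd, show whisker [P] [] (0 : ([] : Obj) ⟶ []) [P] [P] = 0 by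
      simpa using whisker_smul (a := [P]) (b := []) (S := [P]) (T := [P]) 0
        (0 : ([] : Obj) ⟶ []) rfl rfl, Limits.comp_zero, map_zero]
  have s := sum_sum_range_two_mul (f := fun i => π (dotsP (2 * n - 2 - i) ≫
      whisker [P] [] (closure (dotsP i)) [P] [P])) h n
  -- Hence the two merged terms of `closure_whisker` agree and contribute `2`; the remaining `4n` is
  -- `2 * k` for `k = 2n`.
  have e : hollowP ≫ dotsP (2 * n) ≫ hollowP = dotsP (2 * n) := by
    rw [← Category.assoc, hollowP_dotsP_two_mul, Category.assoc, hollow_hollow, Category.comp_id]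
  have e' (a) (ha : a ∈ Finset.range n) : 2 * n - 2 - 2 * (n - 1 - a) = 2 * a := by
    have := Finset.mem_range.1 ha
    omega
  rw [closure_whisker _ (dotsP_even _), map_add, map_add, trace_ptrace_crossing π hπ, s, e,
    Finset.sum_congr rfl fun a ha => by rw [e' a ha]]
  push_cast
  module

/-! ### Passage to the even trace and the two commutators. -/

/-- The trace class as a linear map. -/
noncomputable def trLinear (X : Obj) : homog 0 X X →ₗ[ℂ] EvenTrace :=
  (RingQuot.mkAlgHom ℂ TraceRel).toLinearMap ∘ₗ DirectSum.lof ℂ Obj EvenEnd X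

theorem trClass_comm {p : ZMod 2} {X Y : Obj} {f : X ⟶ Y} {g : Y ⟶ X}
    (hf : f ∈ homog p X Y) (hg : g ∈ homog p Y X) (hfg : f ≫ g ∈ homog 0 X X)
    (hgf : g ≫ f ∈ homog 0 Y Y) : trClass X (f ≫ g) hfg = trClass Y (g ≫ f) hgf :=
  RingQuot.mkAlgHom_rel ℂ (.comm f g hf hg hfg hgf)

theorem trClass_mul {X Y : Obj} (f : X ⟶ X) (g : Y ⟶ Y) (hf : f ∈ homog 0 X X)
    (hg : g ∈ homog 0 Y Y) :
    trClass X f hf * trClass Y g hg = trClass (X ++ Y) (tensor f g) (even_tensor hf hg) := by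
  rw [trClass, trClass, ← map_mul, DirectSum.of_mul_of]
  rfl

/-- `mate` as a linear map between even endomorphisms. -/
noncomputable def mateLinear : homog 0 [P] [P] →ₗ[ℂ] homog 0 [Q] [Q] where
  toFun f := ⟨mate f, mate_mem f.2⟩
  map_add' _ _ := Subtype.ext (mate_add _ _)
  map_smul' _ _ := Subtype.ext (mate_smul _ _)

/-- The bubble slide under a linear functional on even endomorphisms which is a trace. -/
theorem bubble_slide_of_trace {M : Type*} [AddCommGroup M] [Module ℂ M]
    (T : homog 0 [P] [P] →ₗ[ℂ] M)
    (hT : ∀ (p : ZMod 2) (f g : ([P] : Obj) ⟶ [P]), f ∈ homog p [P] [P] → g ∈ homog p [P] [P] →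
      ∀ h h', T ⟨f ≫ g, h⟩ = T ⟨g ≫ f, h'⟩) (n : ℕ) :
    T ⟨whisker [] [P] (cwBubble (2 * n)) [P] [P], whisker_mem (cwBubble_even _) _ _⟩ -
        T ⟨whisker [P] [] (cwBubble (2 * n)) [P] [P], whisker_mem (cwBubble_even _) _ _⟩ =
      (2 + 4 * (n : ℂ)) • T ⟨dotsP (2 * n), dotsP_even _⟩ -
      ∑ a ∈ Finset.range n, (2 + 4 * (a : ℂ)) •
        T ⟨dotsP (2 * a) ≫ whisker [P] [] (cwBubble (2 * (n - 1 - a))) [P] [P],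
          even_comp (dotsP_even _) (whisker_mem (cwBubble_even _) _ _)⟩ := by
  -- `bubble_slide` needs a functional on all endomorphisms, while `T` is defined only on even ones.
  -- The quotient by the image of its kernel avoids extending `T`; a relation between even elements
  -- in it lifts back since the inclusion is injective.
  let K := (LinearMap.ker T).map (homog 0 [P] [P]).subtype
  have hk (p : ZMod 2) (f g : ([P] : Obj) ⟶ [P]) (hf : f ∈ homog p [P] [P])
      (hg : g ∈ homog p [P] [P]) : K.mkQ.toAddMonoidHom (f ≫ g) = K.mkQ.toAddMonoidHom (g ≫ f) := by
    have hp : p + p = 0 := CharTwo.add_self_eq_zero p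
    refine (Submodule.Quotient.eq K).2 ⟨⟨f ≫ g, hp ▸ homog_comp hf hg⟩ -
      ⟨g ≫ f, hp ▸ homog_comp hg hf⟩, ?_, rfl⟩
    exact LinearMap.mem_ker.2 ((map_sub _ _ _).trans (sub_eq_zero.2 (hT p f g hf hg _ _)))
  have key := bubble_slide K.mkQ.toAddMonoidHom hk n
  let A : homog 0 [P] [P] :=
    ⟨whisker [] [P] (cwBubble (2 * n)) [P] [P], whisker_mem (cwBubble_even _) _ _⟩
  let B : homog 0 [P] [P] :=
    ⟨whisker [P] [] (cwBubble (2 * n)) [P] [P], whisker_mem (cwBubble_even _) _ _⟩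
  let C : homog 0 [P] [P] := ⟨dotsP (2 * n), dotsP_even _⟩
  let D (a : ℕ) : homog 0 [P] [P] :=
    ⟨dotsP (2 * a) ≫ whisker [P] [] (cwBubble (2 * (n - 1 - a))) [P] [P],
      even_comp (dotsP_even _) (whisker_mem (cwBubble_even _) _ _)⟩
  let E := A - B - ((2 + 4 * (n : ℂ)) • C - ∑ a ∈ Finset.range n, (2 + 4 * (a : ℂ)) • D a)
  have hE : (E : ([P] : Obj) ⟶ [P]) ∈ K := by
    rw [← Submodule.Quotient.mk_eq_zero, ← Submodule.mkQ_apply]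
    simp only [E, Submodule.coe_sub, Submodule.coe_smul, Submodule.coe_sum, map_sub, map_sum,
      map_smul]
    exact sub_eq_zero.2 key
  obtain ⟨E', hE', h⟩ := hE
  have hT' : T E = 0 := Subtype.ext h ▸ LinearMap.mem_ker.1 hE'
  simp only [E, map_sub, map_sum, map_smul] at hT'
  exact sub_eq_zero.1 hT'

theorem d_mul_up (k : ℕ) : d k * up 0 =
    trLinear [P] ⟨whisker [] [P] (cwBubble k) [P] [P], whisker_mem (cwBubble_even _) _ _⟩ :=
  (trClass_mul _ _ _ _).trans (congrArg (trLinear [P]) (Subtype.ext (whisker_nil_left _).symm))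

theorem up_mul_d (k : ℕ) : up 0 * d k =
    trLinear [P] ⟨whisker [P] [] (cwBubble k) [P] [P], whisker_mem (cwBubble_even _) _ _⟩ :=
  (trClass_mul _ _ _ _).trans (congrArg (trLinear [P]) (Subtype.ext (whisker_nil_right _).symm))

theorem d_mul_down (k : ℕ) : d k * down 0 =
    trLinear [Q] ⟨whisker [] [Q] (cwBubble k) [Q] [Q], whisker_mem (cwBubble_even _) _ _⟩ :=
  (trClass_mul _ _ _ _).trans (congrArg (trLinear [Q]) (Subtype.ext (whisker_nil_left _).symm))

theorem down_mul_d (k : ℕ) : down 0 * d k =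
    trLinear [Q] ⟨whisker [Q] [] (cwBubble k) [Q] [Q], whisker_mem (cwBubble_even _) _ _⟩ :=
  (trClass_mul _ _ _ _).trans (congrArg (trLinear [Q]) (Subtype.ext (whisker_nil_right _).symm))

theorem upBubble_eq (k l : ℕ) : upBubble k l =
    trLinear [P] ⟨dotsP k ≫ whisker [P] [] (cwBubble l) [P] [P],
      even_comp (dotsP_even _) (whisker_mem (cwBubble_even _) _ _)⟩ := by
  refine congrArg (trLinear [P]) (Subtype.ext ?_)
  have h := tensor_comp_tensor_of_even_left (𝟙 ([] : Obj)) (𝟙 ([P] : Obj)) (cwBubble l)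
    (dotsP_even k)
  rw [Category.comp_id, Category.id_comp] at h
  refine h.symm.trans ?_
  change _ = dotsP k ≫ whisker [P] [] (cwBubble l) [P] [P]
  rw [show whisker [P] [] (cwBubble l) [P] [P] = tensor (𝟙 [P]) (cwBubble l) from
    whisker_nil_right _]
  exact congrArg (fun f : ([P] : Obj) ⟶ [P] => f ≫ tensor (𝟙 [P]) (cwBubble l))
    (eq_of_heq (tensor_unit_heq (dotsP k)))

theorem bubbleDown_eq (l k : ℕ) : bubbleDown l k =
    trLinear [Q] ⟨whisker [] [Q] (cwBubble l) [Q] [Q] ≫ dotsQ k,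
      even_comp (whisker_mem (cwBubble_even _) _ _) (dotsQ_even _)⟩ := by
  refine congrArg (trLinear [Q]) (Subtype.ext ?_)
  have h := tensor_comp_tensor_of_even_left (𝟙 ([Q] : Obj)) (𝟙 ([] : Obj)) (dotsQ k)
    (cwBubble_even l)
  rw [Category.comp_id, Category.id_comp] at h
  refine h.symm.trans ?_
  change _ = whisker [] [Q] (cwBubble l) [Q] [Q] ≫ dotsQ k
  rw [show whisker [] [Q] (cwBubble l) [Q] [Q] = tensor (cwBubble l) (𝟙 [Q]) from
    whisker_nil_left _]
  exact congrArg (fun f : ([Q] : Obj) ⟶ [Q] => tensor (cwBubble l) (𝟙 [Q]) ≫ f)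
    (eq_of_heq (unit_tensor_heq (dotsQ k)))

theorem commutator_d_up (n : ℕ) : d (2 * n) * up 0 - up 0 * d (2 * n) =
    (2 + 4 * (n : ℂ)) • up (2 * n) -
      ∑ a ∈ Finset.range n, (2 + 4 * (a : ℂ)) • upBubble (2 * a) (2 * (n - 1 - a)) := by
  simp only [d_mul_up, up_mul_d, upBubble_eq]
  exact bubble_slide_of_trace (M := EvenTrace) (trLinear [P])
    (fun _ _ _ hf hg h h' => trClass_comm hf hg h h') n

/-- The trace class composed with the half turn is again a trace: for `f` and `g` of the same degree
both orders of composition acquire the same Koszul sign. As the half turn swaps the sides of the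
strand, the commutator changes sign. -/
theorem commutator_d_down (n : ℕ) : d (2 * n) * down 0 - down 0 * d (2 * n) =
    -((2 + 4 * (n : ℂ)) • down (2 * n)) +
      ∑ a ∈ Finset.range n, (2 + 4 * (a : ℂ)) • bubbleDown (2 * (n - 1 - a)) (2 * a) := by
  have key := bubble_slide_of_trace (M := EvenTrace) (trLinear [Q] ∘ₗ mateLinear) (fun p f g hf hg h h' => by
    have hp : p + p = 0 := CharTwo.add_self_eq_zero p
    have e₁ : mateLinear ⟨f ≫ g, h⟩ = Diagram.koszul p p •
      (⟨mate g ≫ mate f, hp ▸ homog_comp (mate_mem hg) (mate_mem hf)⟩ : homog 0 [Q] [Q]) :=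
      Subtype.ext (mate_comp hf hg)
    have e₂ : mateLinear ⟨g ≫ f, h'⟩ = Diagram.koszul p p •
      (⟨mate f ≫ mate g, hp ▸ homog_comp (mate_mem hf) (mate_mem hg)⟩ : homog 0 [Q] [Q]) :=
      Subtype.ext (mate_comp hg hf)
    rw [LinearMap.comp_apply, LinearMap.comp_apply, e₁, e₂, map_smul, map_smul]
    exact congrArg _ (trClass_comm (mate_mem hg) (mate_mem hf) _ _)) n
  have m₁ : mateLinear ⟨whisker [] [P] (cwBubble (2 * n)) [P] [P],
      whisker_mem (cwBubble_even _) _ _⟩ =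
      ⟨whisker [Q] [] (cwBubble (2 * n)) [Q] [Q], whisker_mem (cwBubble_even _) _ _⟩ :=
    Subtype.ext (mate_whisker_left _ (cwBubble_even _))
  have m₂ : mateLinear ⟨whisker [P] [] (cwBubble (2 * n)) [P] [P],
      whisker_mem (cwBubble_even _) _ _⟩ =
      ⟨whisker [] [Q] (cwBubble (2 * n)) [Q] [Q], whisker_mem (cwBubble_even _) _ _⟩ :=
    Subtype.ext (mate_whisker_right _ (cwBubble_even _))
  have m₃ : mateLinear ⟨dotsP (2 * n), dotsP_even _⟩ = ⟨dotsQ (2 * n), dotsQ_even _⟩ :=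
    Subtype.ext (mate_dotsP _)
  have m₄ (k l : ℕ) : mateLinear ⟨dotsP k ≫ whisker [P] [] (cwBubble l) [P] [P],
        even_comp (dotsP_even _) (whisker_mem (cwBubble_even _) _ _)⟩ =
      ⟨whisker [] [Q] (cwBubble l) [Q] [Q] ≫ dotsQ k,
        even_comp (whisker_mem (cwBubble_even _) _ _) (dotsQ_even _)⟩ := by
    refine Subtype.ext ((mate_comp (dotsP_even k) (whisker_mem (cwBubble_even l) _ _)).trans ?_)
    rw [koszul_zero_left, one_smul, mate_whisker_right _ (cwBubble_even l), mate_dotsP]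
  simp only [LinearMap.comp_apply, m₁, m₂, m₃, m₄] at key
  simp only [d_mul_down, down_mul_d, bubbleDown_eq]
  have neg_eq {a b c e : EvenTrace} (h : a - b = c - e) : b - a = -c + e := by
    rw [← sub_eq_zero] at h ⊢
    rw [← neg_eq_zero, ← h]
    abel
  exact neg_eq key

end TwistedHeisenberg

theorem mainTheorem8 (n : ℕ) :
    TwistedHeisenberg.d (2 * n) * TwistedHeisenberg.up 0
        - TwistedHeisenberg.up 0 * TwistedHeisenberg.d (2 * n)
      = (2 + 4 * (n : ℂ)) • TwistedHeisenberg.up (2 * n)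
        - ∑ a ∈ Finset.range n,
            (2 + 4 * (a : ℂ)) • TwistedHeisenberg.upBubble (2 * a) (2 * (n - 1 - a)) ∧
    TwistedHeisenberg.d (2 * n) * TwistedHeisenberg.down 0
        - TwistedHeisenberg.down 0 * TwistedHeisenberg.d (2 * n)
      = -((2 + 4 * (n : ℂ)) • TwistedHeisenberg.down (2 * n))
        + ∑ a ∈ Finset.range n,
            (2 + 4 * (a : ℂ)) • TwistedHeisenberg.bubbleDown (2 * (n - 1 - a)) (2 * a) :=
  ⟨TwistedHeisenberg.commutator_d_up n, TwistedHeisenberg.commutator_d_down n⟩
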